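/- **Model.** Let $L,J\ge 1$ and $K\ge 2$ be integers, let $0<\rho\le 1$ and $N_0,W>0$. Messages have classes $(l,j)$, $1\le l\le L$, $1\le j\le J$. A class-$(l,j)$ message has received power $P_j>0$ and service requirement $S_l=-\ln P_{e,l}+\rho\ln M_l$, where $0<P_{e,l}<1$ is the tolerable error probability and $M_l\ge 1$ the (integer) alphabet size. In each time slot $A_{lj}$ messages of class $(l,j)$ arrive; the $A_{lj}$ are independent $\mathbb{Z}_{\ge 0}$-valued random variables with $\mathbb{E}A_{lj}^2<\infty$, and arrivals in different slots are i.i.d. For a schedule $s=(s_{lj})\in\mathbb{Z}_{\ge 0}^{LJ}$ the service quantum of each scheduled message of power class $j$ is $$\phi_j(s)=\rho\ln\Big(1+\frac{P_j}{(1+\rho)\big(N_0W+\sum_{l,i}s_{li}P_i-P_j\big)}\Big)\ \text{ if } \sum_l s_{lj}>0,\qquad \phi_j(s)=0\ \text{ otherwise.}$$ Let $\overline{\mathcal S}_K=\{s:\sum_{l,j}s_{lj}=K\}$, $\overline{\mathcal S}_K(j)=\{s\in\overline{\mathcal S}_K:\sum_l s_{lj}>0\}$, and $$\underline\phi_j=\min_{s\in\overline{\mathcal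 S}_K(j)}\phi_j(s),\quad \overline\phi_j=\max_{s\in\overline{\mathcal S}_K(j)}\phi_j(s),\quad \underline\phi=\min_{s\in\overline{\mathcal S}_K}\sum_{l,j}s_{lj}\phi_j(s).$$ A state $\alpha=((x_1,l_1,j_1),\dots,(x_n,l_n,j_n))$ lists the messages present, with residual service requirements $0<x_k\le S_{l_k}$ and classes $(l_k,j_k)$. A non-idling policy $\omega\in\Omega_K$ assigns to each state $\alpha$ a probability law (a point mass for a deterministic policy) on the sets of exactly $\min(n,K)$ of its messages; in each slot a set is drawn from this law, its messages are transmitted, and $s$ is the vector of the numbers of transmitted messages of the classes. Every transmitted message of power class $j$ has its residual requirement reduced by $\phi_j(s)$ and leaves if the result is $\le 0$; then the messages arriving in the slot are appended to the list, in the order of their classes, with residual requirements $S_l$. This defines a discrete-time Markov chain on the states. **Theorem.** Let $K\ge 2$ and let $\omega\in\Omega_K$ be any non-idling policy. (a) Suppose that $$\sum_{l,j}\mathbb{E}A_{lj}\Big\lceil \frac{S_l}{\underline\phi_j}\Big\rceil<K\qquad\text{or}\qquad \sum_{l,j}\mathbb{E}A_{lj}\,(S_l+\overline\phi_j)<\underline\phi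 .$$ Then on every set $\mathcal X$ of states on which the chain is irreducible (that is, $\mathcal X$ is nonempty, the chain does not leave $\mathcal X$, and all states of $\mathcal X$ are accessible from each other) the chain is positive recurrent, it has exactly one stationary distribution on $\mathcal X$, and under it the mean number of messages of each class is finite. (b) Suppose that for some non-empty $B\subseteq\{1,\dots,J\}$ $$\sum_{l}\sum_{j\in B}S_l\,\mathbb{E}A_{lj}\ \ge\ \max_{s\in\overline{\mathcal S}_K}\sum_{l}\sum_{j\in B}s_{lj}\,\phi_j(s),$$ and that, if equality holds here, then for some $l$ and some $j\in B$ with $\mathbb{E}A_{lj}>0$ the number $S_l$ is not a finite sum of (possibly repeated) numbers $\phi_j(s)$, $s\in\overline{\mathcal S}_K(j)$. Then every state from which infinitely many states are accessible is transient. In particular, the chain is transient whenever it is irreducible on an infinite set of states. -/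

import Mathlib

open scoped ENNReal

noncomputable section

/-! Discrete-time Markov chains given by a transition law `P : S → PMF S`. -/

namespace MarkovChain

variable {S : Type*}

/-- State `y` is accessible from `x` (in zero or more steps of positive probability). -/
def Accessible (P : S → PMF S) (x y : S) : Prop :=
  Relation.ReflTransGen (fun u v => v ∈ (P u).support) x y

/-- `X` is a state space on which the chain lives and is irreducible: it is nonempty, the chain
never leaves it, and any two of its states are accessible from each other. -/
structure IsIrreducibleOn (P : S → PMF S) (X : Set S) : Prop where
  nonempty : X.Nonempty
  closed : ∀ x ∈ X, (P x).support ⊆ X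
  accessible : ∀ x ∈ X, ∀ y ∈ X, Accessible P x y

/-- `firstPassage P y n x` is the probability that the chain started in `x` is in `y` at time
`n + 1` and not at any of the times `1, …, n`. -/
def firstPassage (P : S → PMF S) (y : S) : ℕ → S → ℝ≥0∞
  | 0, x => P x y
  | n + 1, x => ∑' z : {z : S // z ≠ y}, P x z * firstPassage P y n z

/-- The probability that the chain started in `x` ever returns to `x`. -/
def returnProb (P : S → PMF S) (x : S) : ℝ≥0∞ := ∑' n : ℕ, firstPassage P x n x

/-- A state is transient if the return to it is not certain. -/
def IsTransientState (P : S → PMF S) (x : S) : Prop := returnProb P x < 1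

/-- A state is positive recurrent if the return to it is certain and its mean return time
is finite. -/
def IsPosRecurrentState (P : S → PMF S) (x : S) : Prop :=
  returnProb P x = 1 ∧ ∑' n : ℕ, ((n : ℝ≥0∞) + 1) * firstPassage P x n x < ∞

/-- `π` is a stationary distribution of the chain on the state space `X`. -/
def IsStationaryOn (P : S → PMF S) (X : Set S) (π : PMF S) : Prop :=
  π.support ⊆ X ∧ π.bind P = π

end MarkovChain

/-- The data of the multiaccess message communication system, with `L` service requirement
classes and `J` received power classes. -/
structure MessageSystem (L J : ℕ) where
  L_pos : 0 < L
  J_pos : 0 < J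
  /-- the parameter of the random coding bound -/
  ρ : ℝ
  ρ_pos : 0 < ρ
  ρ_le_one : ρ ≤ 1
  /-- noise power spectral density -/
  N₀ : ℝ
  N₀_pos : 0 < N₀
  /-- bandwidth -/
  W : ℝ
  W_pos : 0 < W
  /-- received powers -/
  P : Fin J → ℝ
  P_pos : ∀ j, 0 < P j
  /-- tolerable message decoding error probabilities -/
  Pe : Fin L → ℝ
  Pe_pos : ∀ l, 0 < Pe l
  Pe_lt_one : ∀ l, Pe l < 1
  /-- message alphabet sizes -/
  M : Fin L → ℕ
  M_pos : ∀ l, 1 ≤ M l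
  /-- `p l j` is the law of the number `A_lj` of class-`(l, j)` messages arriving in a slot -/
  p : Fin L → Fin J → PMF ℕ
  /-- `A_lj` has a finite second moment (hence also a finite mean) -/
  second_moment : ∀ l j, ∑' k : ℕ, p l j k * (k : ℝ≥0∞) ^ 2 < ∞

/-- A schedule (or any other vector of message counts), indexed by the classes `(l, j)`. -/
abbrev Schedule (L J : ℕ) : Type := Fin L × Fin J → ℕ

/-- A message in the system: residual service requirement and class. -/
structure Message (L J : ℕ) where
  residual : ℝ
  l : Fin L
  j : Fin J

/-- The state of the system: the vector of the messages that are present. -/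
abbrev SysState (L J : ℕ) : Type := List (Message L J)

/-- The number of class-`(l, j)` messages in a state. -/
def SysState.count {L J : ℕ} (α : SysState L J) (l : Fin L) (j : Fin J) : ℕ :=
  α.countP fun m => decide (m.l = l ∧ m.j = j)

namespace MessageSystem

variable {L J : ℕ} (𝓜 : MessageSystem L J)

/-- Service requirement `S_l = - ln P_{e,l} + ρ ln M_l`. -/
def S (l : Fin L) : ℝ := -Real.log (𝓜.Pe l) + 𝓜.ρ * Real.log (𝓜.M l)

/-- The mean `E A_lj`. -/
def meanA (l : Fin L) (j : Fin J) : ℝ := ∑' k : ℕ, (𝓜.p l j k).toReal * (k : ℝ)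

/-- `φ_j(s)`: the service quantum that each scheduled message of power class `j` receives in a
slot under the schedule `s`; its effective noise is the thermal noise together with the powers of
all other scheduled messages. It is `0` if `s` schedules no message of power class `j`. -/
def φ (j : Fin J) (s : Schedule L J) : ℝ :=
  if 0 < ∑ l, s (l, j) then
    𝓜.ρ * Real.log (1 + 𝓜.P j /
      ((1 + 𝓜.ρ) * (𝓜.N₀ * 𝓜.W + ((∑ c : Fin L × Fin J, (s c : ℝ) * 𝓜.P c.2) - 𝓜.P j))))
  else 0

/-- The schedules with exactly `K` messages. -/
def fullSchedules (L J K : ℕ) : Set (Schedule L J) := {s | ∑ c, s c = K}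

/-- The schedules with exactly `K` messages, at least one of them of power class `j`. -/
def fullSchedulesAt (L J K : ℕ) (j : Fin J) : Set (Schedule L J) :=
  {s | s ∈ fullSchedules L J K ∧ 0 < ∑ l, s (l, j)}

/- For `K ≥ 1` the minima and maxima below are over finite nonempty sets, so they are attained. -/

/-- The smallest quantum `min φ_j(s)` over the full schedules that contain power class `j`. -/
def φmin (K : ℕ) (j : Fin J) : ℝ := sInf (𝓜.φ j '' fullSchedulesAt L J K j)

/-- The largest quantum `max φ_j(s)` over the full schedules that contain power class `j`. -/
def φmax (K : ℕ) (j : Fin J) : ℝ := sSup (𝓜.φ j '' fullSchedulesAt L J K j)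

/-- The total quantum that a schedule offers to the power classes in `B`. -/
def totalQuantum (B : Finset (Fin J)) (s : Schedule L J) : ℝ :=
  ∑ l, ∑ j ∈ B, (s (l, j) : ℝ) * 𝓜.φ j s

/-- The minimum, over the full schedules, of the total quantum offered to all messages. -/
def φtot (K : ℕ) : ℝ := sInf (𝓜.totalQuantum Finset.univ '' fullSchedules L J K)

/-- The maximum, over the full schedules, of the total quantum offered to the classes in `B`. -/
def maxQuantum (K : ℕ) (B : Finset (Fin J)) : ℝ :=
  sSup (𝓜.totalQuantum B '' fullSchedules L J K)

/-- The law of the vector of the numbers of arrivals in a slot: the `A_lj` are independent. -/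
def arrivals : PMF (Schedule L J) :=
  (MeasureTheory.Measure.pi fun c : Fin L × Fin J => (𝓜.p c.1 c.2).toMeasure).toPMF

/-- The list of new messages (with their full service requirement) for an arrival vector `a`. -/
def newMessages (a : Schedule L J) : SysState L J :=
  (List.finRange L).flatMap fun l => (List.finRange J).flatMap fun j =>
    List.replicate (a (l, j)) ⟨𝓜.S l, l, j⟩

/-- The schedule obtained by transmitting exactly the messages of `α` at the positions in `T`. -/
def scheduleOf (α : SysState L J) (T : Finset (Fin α.length)) : Schedule L J := fun c =>
  (T.filter fun k => (α.get k).l = c.1 ∧ (α.get k).j = c.2).card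

/-- The state after the messages at the positions in `T` have been served in a slot: each of them
receives its quantum and leaves if its residual requirement is exhausted. -/
def serve (α : SysState L J) (T : Finset (Fin α.length)) : SysState L J :=
  (List.finRange α.length).filterMap fun k =>
    let m := α.get k
    let q := 𝓜.φ m.j (scheduleOf α T)
    if k ∈ T then
      if m.residual ≤ q then none else some { m with residual := m.residual - q }
    else some m

/-- A state is admissible if all residual requirements are positive and do not exceed the
service requirements of the messages. -/
def Admissible (α : SysState L J) : Prop := ∀ m ∈ α, 0 < m.residual ∧ m.residual ≤ 𝓜.S m.l

end MessageSystem

/-- A (deterministic or random) non-idling scheduling policy with at most `K` simultaneous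
transmissions: in every state it picks at random, by a law depending on the state, which messages
are transmitted, and these are as many as possible, namely `min n K` if there are `n` messages.
Deterministic policies are those whose laws are point masses. -/
structure NonIdlingPolicy (L J K : ℕ) where
  select : (α : SysState L J) → PMF (Finset (Fin α.length))
  nonIdling : ∀ α, ∀ T ∈ (select α).support, T.card = min α.length K

/-- The transition law of the Markov chain: in a slot the selected messages are served, and then
the newly arrived messages join. -/
def MessageSystem.transition {L J K : ℕ} (𝓜 : MessageSystem L J) (ω : NonIdlingPolicy L J K)
    (α : SysState L J) : PMF (SysState L J) :=
  (ω.select α).bind fun T => 𝓜.arrivals.map fun a => 𝓜.serve α T ++ 𝓜.newMessages a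

end

/-! The backlog is measured by an additive weight: a message of power class `j` with residual `r`
counts `w j r`, where `w j` is monotone and vanishes for `r ≤ 0`. In one slot the weight falls by
`decrease` and rises by the load of the new messages, whose mean is `meanLoad w` and whose second
moment is finite. A non-idling policy serves exactly `K` messages once `K` are present, so a bound
on `decrease` over all `K`-element sets holds for every policy. Both halves compare such a bound `D`
with `meanLoad w`.

For (a), let `decrease ≥ D > meanLoad w`. Then the squared weight has drift at most a constant minus
a multiple of the weight (`expect_sq_weight_add_le`). Only finitely many accessible states have
boundedly many messages (`finite_accessible_length_le`), so Foster's criterion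
`posRecurrent_of_drift` applies and also bounds the stationary mean weight. The two conditions come
from two weights: `slotWeight` loses at least one per served message, `quantumWeight` at least the
quantum served.

For (b), let `decrease ≤ D < meanLoad w`. A decaying exponential of the weight, truncated at one, is
then superharmonic and drops below one at some accessible state, which excludes certain return
(`isTransientState_of_superharmonic`). The weight is `exhaustingWeight`, the least sum of
full-schedule quanta that covers the residual. One service lowers it by at most the quantum, yet a
new message weighs strictly more than `S_l` when `S_l` is not itself such a sum; this settles the
case of equality. -/

namespace MarkovChain

variable {S : Type*}

/-! ### Expectations and the chain killed at a state -/

/-- The expectation of `f` under the law `p`. -/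
noncomputable def expect (p : PMF S) (f : S → ℝ≥0∞) : ℝ≥0∞ := ∑' x, p x * f x

theorem expect_bind {R : Type*} (p : PMF R) (q : R → PMF S) (f : S → ℝ≥0∞) :
    expect (p.bind q) f = expect p fun r => expect (q r) f := by
  simp only [expect, PMF.bind_apply, ← ENNReal.tsum_mul_right, ← ENNReal.tsum_mul_left]
  rw [ENNReal.tsum_comm]
  simp only [mul_assoc]

theorem expect_pure (x : S) (f : S → ℝ≥0∞) : expect (PMF.pure x) f = f x := by
  rw [expect, tsum_eq_single x]
  · simp
  · intro y hy
    simp [hy]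

theorem expect_map {R : Type*} (p : PMF R) (g : R → S) (f : S → ℝ≥0∞) :
    expect (p.map g) f = expect p (f ∘ g) := by
  rw [← PMF.bind_pure_comp, expect_bind]
  simp only [Function.comp_def, expect_pure]

theorem expect_const (p : PMF S) (c : ℝ≥0∞) : expect p (fun _ => c) = c := by
  rw [expect, ENNReal.tsum_mul_right, p.tsum_coe, one_mul]

theorem expect_add (p : PMF S) (f g : S → ℝ≥0∞) :
    expect p (fun x => f x + g x) = expect p f + expect p g := by
  simp only [expect, mul_add, ENNReal.tsum_add]

theorem expect_const_mul (p : PMF S) (c : ℝ≥0∞) (f : S → ℝ≥0∞) :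
    expect p (fun x => c * f x) = c * expect p f := by
  simp only [expect, mul_left_comm _ c, ENNReal.tsum_mul_left]

theorem expect_mono {p : PMF S} {f g : S → ℝ≥0∞} (h : ∀ x ∈ p.support, f x ≤ g x) :
    expect p f ≤ expect p g := by
  refine ENNReal.tsum_le_tsum fun x => ?_
  by_cases hx : x ∈ p.support
  · exact mul_le_mul_right (h x hx) _
  · simp [(p.apply_eq_zero_iff x).2 hx]

/-- The transition operator of the chain killed when it enters `y`. -/
noncomputable def taboo (P : S → PMF S) (y : S) (f : S → ℝ≥0∞) (x : S) : ℝ≥0∞ :=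
  expect (P x) (({y}ᶜ : Set S).indicator f)

theorem expect_eq_taboo (P : S → PMF S) (y : S) (f : S → ℝ≥0∞) (x : S) :
    expect (P x) f = P x y * f y + taboo P y f x := by
  have h : f = fun z => ({y} : Set S).indicator f z + ({y}ᶜ : Set S).indicator f z := by
    funext z
    exact (Set.indicator_self_add_compl_apply {y} f z).symm
  conv_lhs => rw [h]
  rw [expect_add, taboo]
  congr 1
  rw [expect, tsum_eq_single y]
  · simp
  · intro z hz
    simp [hz]

theorem taboo_add (P : S → PMF S) (y : S) (f g : S → ℝ≥0∞) (x : S) :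
    taboo P y (fun z => f z + g z) x = taboo P y f x + taboo P y g x := by
  simp only [taboo, ← expect_add]
  congr 1
  funext z
  exact congrFun (Set.indicator_add ({y}ᶜ : Set S) f g) z

theorem taboo_const_mul (P : S → PMF S) (y : S) (c : ℝ≥0∞) (f : S → ℝ≥0∞) (x : S) :
    taboo P y (fun z => c * f z) x = c * taboo P y f x := by
  simp only [taboo, ← expect_const_mul]
  congr 1
  funext z
  by_cases hz : z = y <;> simp [hz]

theorem taboo_mono {P : S → PMF S} {y : S} {f g : S → ℝ≥0∞} {x : S}
    (h : ∀ z ∈ (P x).support, f z ≤ g z) : taboo P y f x ≤ taboo P y g x := by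
  refine expect_mono fun z hz => ?_
  by_cases hzy : z = y
  · simp [hzy]
  · simpa [hzy] using h z hz

theorem taboo_le_expect (P : S → PMF S) (y : S) (f : S → ℝ≥0∞) (x : S) :
    taboo P y f x ≤ expect (P x) f :=
  expect_mono fun z _ => Set.indicator_le_self _ _ z

theorem taboo_tsum (P : S → PMF S) (y : S) (f : ℕ → S → ℝ≥0∞) (x : S) :
    taboo P y (fun z => ∑' n, f n z) x = ∑' n, taboo P y (f n) x := by
  simp only [taboo, expect]
  rw [ENNReal.tsum_comm]
  refine tsum_congr fun z => ?_
  rw [ENNReal.tsum_mul_left]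
  by_cases hzy : z = y <;> simp [hzy]

theorem taboo_one_add (P : S → PMF S) (y x : S) :
    P x y + taboo P y (fun _ => 1) x = 1 := by
  have h := expect_eq_taboo P y (fun _ => 1) x
  rw [expect_const, mul_one] at h
  exact h.symm

theorem firstPassage_succ (P : S → PMF S) (y : S) (n : ℕ) :
    firstPassage P y (n + 1) = taboo P y (firstPassage P y n) := by
  funext x
  simp only [firstPassage, taboo, expect]
  rw [show (∑' z : {z : S // z ≠ y}, P x z * firstPassage P y n z) =
    ∑' z : ({y}ᶜ : Set S), P x z * firstPassage P y n z from rfl,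
    tsum_subtype ({y}ᶜ : Set S) (fun z => P x z * firstPassage P y n z)]
  refine tsum_congr fun z => ?_
  by_cases hzy : z = y <;> simp [hzy]

/-- The sum of the iterates of the killed chain applied to a cost function: the expected cost
before the first passage to `y`. -/
noncomputable def costBefore (P : S → PMF S) (y : S) (c : S → ℝ≥0∞) (x : S) : ℝ≥0∞ :=
  ∑' n : ℕ, (taboo P y)^[n] c x

theorem costBefore_eq (P : S → PMF S) (y : S) (c : S → ℝ≥0∞) (x : S) :
    costBefore P y c x = c x + taboo P y (costBefore P y c) x := by
  have h : costBefore P y c = fun z => ∑' n : ℕ, (taboo P y)^[n] c z := rfl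
  conv_rhs => rw [h, taboo_tsum]
  rw [costBefore, tsum_eq_zero_add' ENNReal.summable]
  simp only [Function.iterate_succ_apply', Function.iterate_zero, id]

theorem sum_iterate_succ (P : S → PMF S) (y : S) (c : S → ℝ≥0∞) (N : ℕ) (x : S) :
    ∑ n ∈ Finset.range (N + 1), (taboo P y)^[n] c x =
      c x + taboo P y (fun z => ∑ n ∈ Finset.range N, (taboo P y)^[n] c z) x := by
  have key : ∀ N : ℕ, taboo P y (fun z => ∑ n ∈ Finset.range N, (taboo P y)^[n] c z) x =
      ∑ n ∈ Finset.range N, (taboo P y)^[n + 1] c x := by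
    intro N
    induction N with
    | zero => simp [taboo, expect]
    | succ N ih =>
      simp only [Finset.sum_range_succ, taboo_add, ih, Function.iterate_succ_apply']
  rw [Finset.sum_range_succ', key, add_comm]
  rfl

/-- Comparison principle: the partial sums of the cost start at zero, and the supersolution
inequality passes from each to the next because the killed operator is monotone. The bounds on
hitting probabilities and return times below are instances. -/
theorem costBefore_le {P : S → PMF S} {y : S} {c v : S → ℝ≥0∞} {X : Set S}
    (hX : ∀ x ∈ X, (P x).support ⊆ X) (h : ∀ x ∈ X, c x + taboo P y v x ≤ v x) :
    ∀ x ∈ X, costBefore P y c x ≤ v x := by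
  have key : ∀ N : ℕ, ∀ x ∈ X, ∑ n ∈ Finset.range N, (taboo P y)^[n] c x ≤ v x := by
    intro N
    induction N with
    | zero => simp
    | succ N ih =>
      intro x hx
      rw [sum_iterate_succ]
      exact (add_le_add_right (taboo_mono fun z hz => ih z (hX x hx hz)) _).trans (h x hx)
  intro x hx
  exact ENNReal.tsum_le_of_sum_range_le fun N => key N x hx

/-! ### Transience -/

/-- The probability that the chain started in `x` is in `y` at some time `n ≥ 1`. -/
noncomputable def hitProb (P : S → PMF S) (y : S) : S → ℝ≥0∞ :=
  costBefore P y fun x => P x y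

theorem firstPassage_eq_iterate (P : S → PMF S) (y : S) (n : ℕ) :
    firstPassage P y n = (taboo P y)^[n] fun x => P x y := by
  induction n with
  | zero => rfl
  | succ n ih => rw [firstPassage_succ, ih, Function.iterate_succ_apply']

theorem returnProb_eq (P : S → PMF S) (x : S) : returnProb P x = hitProb P x x := by
  simp only [returnProb, firstPassage_eq_iterate, hitProb, costBefore]

theorem hitProb_le_one (P : S → PMF S) (y x : S) : hitProb P y x ≤ 1 :=
  costBefore_le (v := fun _ => 1) (X := Set.univ) (fun _ _ => Set.subset_univ _)
    (fun x _ => (taboo_one_add P y x).le) x (Set.mem_univ x)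

theorem hitProb_le {P : S → PMF S} {y : S} {u : S → ℝ≥0∞} {X : Set S}
    (hX : ∀ x ∈ X, (P x).support ⊆ X) (hu : ∀ x ∈ X, expect (P x) u ≤ u x) (hy : 1 ≤ u y) :
    ∀ x ∈ X, hitProb P y x ≤ u x := by
  refine costBefore_le hX fun x hx => le_trans ?_ (hu x hx)
  rw [expect_eq_taboo P y]
  gcongr
  exact le_mul_of_one_le_right' hy

/-- Maximum principle: when return to `y` is certain, the hitting probability is harmonic, and an
average of values at most one equals one only if every successor has value one. -/
theorem hitProb_eq_one_of_mem_support {P : S → PMF S} {y x z : S} (hy : hitProb P y y = 1)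
    (hx : hitProb P y x = 1) (hz : z ∈ (P x).support) : hitProb P y z = 1 := by
  by_contra hne
  have hlt : hitProb P y z < 1 := lt_of_le_of_ne (hitProb_le_one P y z) hne
  have hx' : expect (P x) (hitProb P y) = 1 := by
    rw [expect_eq_taboo P y, hy, mul_one, ← hx]
    exact (costBefore_eq P y (fun x => P x y) x).symm
  have : expect (P x) (hitProb P y) < ∑' z, P x z := by
    refine ENNReal.tsum_lt_tsum (i := z) ?_ (fun w => ?_) ?_
    · rw [← expect, hx']
      exact ENNReal.one_ne_top
    · exact mul_le_of_le_one_right' (hitProb_le_one P y w)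
    · calc P x z * hitProb P y z < P x z * 1 :=
            ENNReal.mul_lt_mul_right ((P x).mem_support_iff z |>.1 hz) ((P x).apply_ne_top z) hlt
        _ = P x z := mul_one _
  rw [hx', PMF.tsum_coe] at this
  exact lt_irrefl _ this

/-- A state is transient if there is a superharmonic function that is at least `1` there and less
than `1` at some accessible state. -/
theorem isTransientState_of_superharmonic {P : S → PMF S} {y β : S} (u : S → ℝ≥0∞)
    (hu : ∀ x, Accessible P y x → expect (P x) u ≤ u x) (hy : 1 ≤ u y)
    (hβ : Accessible P y β) (hlt : u β < 1) : IsTransientState P y := by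
  by_contra hne
  have h1 : hitProb P y y = 1 := by
    rw [← returnProb_eq]
    refine le_antisymm ?_ (not_lt.1 hne)
    rw [returnProb_eq]
    exact hitProb_le_one P y y
  have hall : ∀ x, Accessible P y x → hitProb P y x = 1 := by
    intro x hx
    induction hx with
    | refl => exact h1
    | tail _ hz ih => exact hitProb_eq_one_of_mem_support h1 ih hz
  have := hitProb_le (X := {x | Accessible P y x})
    (fun x hx z hz => Relation.ReflTransGen.tail hx hz) hu hy β hβ
  rw [hall β hβ] at this
  exact absurd hlt (not_lt.2 this)

/-! ### Positive recurrence -/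

/-- The probability that the chain started in `x` is not in `y` at the times `1, …, n`. -/
noncomputable def surv (P : S → PMF S) (y : S) (n : ℕ) : S → ℝ≥0∞ := (taboo P y)^[n] fun _ => 1

theorem surv_succ (P : S → PMF S) (y : S) (n : ℕ) (x : S) :
    surv P y (n + 1) x = taboo P y (surv P y n) x := by
  rw [surv, Function.iterate_succ_apply']; rfl

theorem surv_eq_add (P : S → PMF S) (y : S) (n : ℕ) (x : S) :
    surv P y n x = firstPassage P y n x + surv P y (n + 1) x := by
  induction n generalizing x with
  | zero => exact (taboo_one_add P y x).symm
  | succ n ih =>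
    rw [surv_succ, firstPassage_succ, surv_succ, ← taboo_add]
    congr 1
    funext z
    exact ih z

theorem surv_antitone (P : S → PMF S) (y x : S) : Antitone fun n => surv P y n x :=
  antitone_nat_of_succ_le fun n => by
    rw [surv_eq_add P y n x]
    exact le_add_self

theorem surv_le_one (P : S → PMF S) (y : S) (n : ℕ) (x : S) : surv P y n x ≤ 1 :=
  surv_antitone P y x (Nat.zero_le n)

theorem surv_succ_lt_one {P : S → PMF S} {y x z : S} {n : ℕ} (hz : z ∈ (P x).support)
    (h : z = y ∨ surv P y n z < 1) : surv P y (n + 1) x < 1 := by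
  rw [surv_succ]
  have hind : ∀ w, ({y}ᶜ : Set S).indicator (surv P y n) w ≤ 1 := fun w =>
    (Set.indicator_le_self _ _ w).trans (surv_le_one P y n w)
  have : expect (P x) (({y}ᶜ : Set S).indicator (surv P y n)) < ∑' z, P x z := by
    refine ENNReal.tsum_lt_tsum (i := z) ?_ (fun w => ?_) ?_
    · refine ne_top_of_le_ne_top ENNReal.one_ne_top ?_
      rw [← (P x).tsum_coe]
      exact ENNReal.tsum_le_tsum fun w => mul_le_of_le_one_right' (hind w)
    · exact mul_le_of_le_one_right' (hind w)
    · calc P x z * ({y}ᶜ : Set S).indicator (surv P y n) z < P x z * 1 := by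
            refine ENNReal.mul_lt_mul_right ((P x).mem_support_iff z |>.1 hz)
              ((P x).apply_ne_top z) ?_
            by_cases hzy : z = y
            · simp [hzy]
            · simpa [hzy] using h.resolve_left hzy
        _ = P x z := mul_one _
  rwa [PMF.tsum_coe] at this

theorem exists_surv_lt_one {P : S → PMF S} {X : Set S} (hX : IsIrreducibleOn P X) {y x : S}
    (hy : y ∈ X) (hx : x ∈ X) : ∃ n, surv P y n x < 1 := by
  have key : ∀ z, Accessible P z y → z = y ∨ ∃ n, surv P y n z < 1 := by
    intro z hz
    induction hz using Relation.ReflTransGen.head_induction_on with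
    | refl => exact Or.inl rfl
    | head h _ ih =>
      rcases ih with rfl | ⟨n, hn⟩
      · exact Or.inr ⟨1, surv_succ_lt_one h (Or.inl rfl)⟩
      · exact Or.inr ⟨n + 1, surv_succ_lt_one h (Or.inr hn)⟩
  -- For `x = y` the empty path says nothing about survival, so one actual step is taken before
  -- following a path to `y`.
  obtain ⟨z, hz⟩ := (P x).support_nonempty
  rcases key z (hX.accessible z (hX.closed x hx hz) y hy) with rfl | ⟨n, hn⟩
  · exact ⟨1, surv_succ_lt_one hz (Or.inl rfl)⟩
  · exact ⟨n + 1, surv_succ_lt_one hz (Or.inr hn)⟩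

/-- Tail-sum formula: the cost of one per step is the sum of the survival probabilities. If it is
finite, survival tends to zero, which makes return certain, and exchanging sums turns it into the
mean return time. -/
theorem isPosRecurrentState_of_costBefore_ne_top {P : S → PMF S} {y : S}
    (h : costBefore P y (fun _ => 1) y ≠ ∞) : IsPosRecurrentState P y := by
  have h0 : Filter.Tendsto (fun n => surv P y n y) Filter.atTop (nhds 0) :=
    ENNReal.tendsto_atTop_zero_of_tsum_ne_top h
  have hsum : ∀ n N : ℕ, surv P y n y =
      ∑ k ∈ Finset.range N, firstPassage P y (k + n) y + surv P y (N + n) y := by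
    intro n N
    induction N with
    | zero => simp
    | succ N ih =>
      rw [ih, Finset.sum_range_succ, surv_eq_add P y (N + n) y, ← add_assoc,
        Nat.add_right_comm N n 1]
  have htail : ∀ n : ℕ, ∑' k : ℕ, firstPassage P y (k + n) y = surv P y n y := by
    intro n
    have h1 : Filter.Tendsto (fun N => ∑ k ∈ Finset.range N, firstPassage P y (k + n) y +
        surv P y (N + n) y) Filter.atTop (nhds (∑' k : ℕ, firstPassage P y (k + n) y + 0)) :=
      ENNReal.summable.hasSum.tendsto_sum_nat.add
        (h0.comp (Filter.tendsto_add_atTop_nat n))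
    simp only [← hsum n, add_zero] at h1
    exact tendsto_nhds_unique tendsto_const_nhds h1 |>.symm
  refine ⟨htail 0, ?_⟩
  have hT : costBefore P y (fun _ => 1) y =
      ∑' n : ℕ, ((n : ℝ≥0∞) + 1) * firstPassage P y n y := by
    have : costBefore P y (fun _ => 1) y = ∑' n : ℕ, ∑' k : ℕ, firstPassage P y (k + n) y :=
      tsum_congr fun n => (htail n).symm
    have hshift : ∀ n : ℕ, ∑' k : ℕ, firstPassage P y (k + n) y =
        ∑' k : ℕ, if n ≤ k then firstPassage P y k y else 0 := by
      intro n
      rw [← Summable.sum_add_tsum_nat_add' (f := fun k => if n ≤ k then firstPassage P y k y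
        else 0) (k := n) ENNReal.summable, Finset.sum_eq_zero, zero_add]
      · simp only [le_add_iff_nonneg_left, zero_le, if_true]
      · intro k hk
        simp [Finset.mem_range.1 hk]
    rw [this, tsum_congr hshift, ENNReal.tsum_comm]
    refine tsum_congr fun k => ?_
    rw [tsum_eq_sum (s := Finset.range (k + 1))]
    · rw [Finset.sum_congr rfl (g := fun _ => firstPassage P y k y)]
      · simp
      · intro n hn
        simp [Nat.lt_succ_iff.1 (Finset.mem_range.1 hn)]
    · intro n hn
      rw [if_neg]
      intro h
      exact hn (Finset.mem_range.2 (Nat.lt_succ_of_le h))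
  rw [← hT]
  exact h.lt_top

/-- Foster's criterion: under a drift condition with finite sublevel sets the mean return time
of every state is finite. -/
theorem costBefore_one_ne_top {P : S → PMF S} {X : Set S} (hX : IsIrreducibleOn P X)
    {f g : S → ℝ≥0∞} {C : ℝ≥0∞} (hC : C ≠ ∞) (hf : ∀ x ∈ X, f x ≠ ∞)
    (hd : ∀ x ∈ X, expect (P x) f + g x ≤ f x + C)
    (hfin : {x | x ∈ X ∧ g x ≤ C + 1}.Finite) {y : S} (hy : y ∈ X) :
    ∀ x ∈ X, costBefore P y (fun _ => 1) x ≠ ∞ := by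
  -- Survival decreases in time, so one horizon serves all states of the finite exceptional set.
  obtain ⟨N, hN⟩ : ∃ N, ∀ x ∈ X, g x ≤ C + 1 → surv P y N x < 1 := by
    choose! n hn using fun x (hx : x ∈ X) => exists_surv_lt_one hX hy hx
    refine ⟨hfin.toFinset.sup n, fun x hx hgx => lt_of_le_of_lt (surv_antitone P y x ?_) (hn x hx)⟩
    exact Finset.le_sup (hfin.mem_toFinset.2 ⟨hx, hgx⟩)
  -- On the exceptional set `f` may grow by up to `C`. `M` is so large that `M` times the chance of
  -- hitting `y` within `N` steps pays for `C` and one unit of time.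
  obtain ⟨M, hM, hMA⟩ : ∃ M : ℝ≥0∞, M ≠ ∞ ∧ ∀ x ∈ X, g x ≤ C + 1 →
      C + 1 ≤ M * (1 - surv P y N x) := by
    refine ⟨∑ x ∈ hfin.toFinset, (C + 1) / (1 - surv P y N x), ?_, fun x hx hgx => ?_⟩
    · refine ENNReal.sum_ne_top.2 fun x hx => ?_
      have hx' := hfin.mem_toFinset.1 hx
      exact ENNReal.div_ne_top (by finiteness) (tsub_pos_of_lt (hN x hx'.1 hx'.2)).ne'
    · have h0 : 1 - surv P y N x ≠ 0 := (tsub_pos_of_lt (hN x hx hgx)).ne'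
      have h1 : 1 - surv P y N x ≠ ∞ := by finiteness
      calc C + 1 = (C + 1) / (1 - surv P y N x) * (1 - surv P y N x) :=
            (ENNReal.div_mul_cancel h0 h1).symm
        _ ≤ _ := by
            gcongr
            exact Finset.single_le_sum (f := fun x => (C + 1) / (1 - surv P y N x))
              (fun _ _ => zero_le) (hfin.mem_toFinset.2 ⟨hx, hgx⟩)
  -- `s` is the mean of the hitting time truncated at `N`. A killed step lowers it by `1 - surv P y
  -- N x`, so `f + M * s` decreases by at least one throughout `X`.
  set s : S → ℝ≥0∞ := fun z => ∑ n ∈ Finset.range N, (taboo P y)^[n] (fun _ => 1) z with hs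
  have hstep : ∀ x, 1 + taboo P y s x = s x + surv P y N x := by
    intro x
    exact (sum_iterate_succ P y (fun _ => 1) N x).symm.trans (Finset.sum_range_succ _ _)
  have hs_ne_top : ∀ x, s x ≠ ∞ := fun x =>
    ENNReal.sum_ne_top.2 fun n _ => ne_top_of_le_ne_top ENNReal.one_ne_top (surv_le_one P y n x)
  have hstep' : ∀ x, taboo P y s x + (1 - surv P y N x) = s x := by
    intro x
    have hsv : surv P y N x ≠ ∞ := ne_top_of_le_ne_top ENNReal.one_ne_top (surv_le_one P y N x)
    refine (ENNReal.add_left_inj hsv).1 ?_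
    rw [add_assoc, tsub_add_cancel_of_le (surv_le_one P y N x), add_comm, hstep]
  intro x hx
  refine ne_top_of_le_ne_top ?_ (costBefore_le (v := fun z => f z + M * s z) hX.closed ?_ x hx)
  · exact ENNReal.add_ne_top.2 ⟨hf x hx, ENNReal.mul_ne_top hM (hs_ne_top x)⟩
  · intro x hx
    rw [taboo_add, taboo_const_mul]
    have hd' : taboo P y f x + g x ≤ f x + C :=
      (add_le_add_left (taboo_le_expect P y f x) _).trans (hd x hx)
    refine (ENNReal.add_le_add_iff_right hC).1 ?_
    by_cases hgx : g x ≤ C + 1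
    · calc 1 + (taboo P y f x + M * taboo P y s x) + C
          = taboo P y f x + (M * taboo P y s x + (C + 1)) := by ring
        _ ≤ (f x + C) + (M * taboo P y s x + M * (1 - surv P y N x)) := by
            gcongr
            · exact le_self_add.trans hd'
            · exact hMA x hx hgx
        _ = f x + M * s x + C := by rw [← mul_add, hstep']; ring
    · calc 1 + (taboo P y f x + M * taboo P y s x) + C
          = (taboo P y f x + (C + 1)) + M * taboo P y s x := by ring
        _ ≤ (f x + C) + M * s x := by
            refine add_le_add ((add_le_add_right (not_le.1 hgx).le _).trans hd') ?_
            gcongr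
            rw [← hstep' x]
            exact le_self_add
        _ = f x + M * s x + C := by ring

/-- Once mean hitting times are finite, adding `C` times the hitting time to `f` absorbs the
constant in the drift condition and leaves a supersolution for the cost `g`. -/
theorem costBefore_ne_top {P : S → PMF S} {X : Set S} (hX : IsIrreducibleOn P X)
    {f g : S → ℝ≥0∞} {C : ℝ≥0∞} (hC : C ≠ ∞) (hf : ∀ x ∈ X, f x ≠ ∞)
    (hd : ∀ x ∈ X, expect (P x) f + g x ≤ f x + C)
    (hfin : {x | x ∈ X ∧ g x ≤ C + 1}.Finite) {y : S} (hy : y ∈ X) :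
    ∀ x ∈ X, costBefore P y g x ≠ ∞ := by
  have hT := costBefore_one_ne_top hX hC hf hd hfin hy
  intro x hx
  refine ne_top_of_le_ne_top ?_ (costBefore_le
    (v := fun z => f z + C * costBefore P y (fun _ => 1) z) hX.closed ?_ x hx)
  · exact ENNReal.add_ne_top.2 ⟨hf x hx, ENNReal.mul_ne_top hC (hT x hx)⟩
  · intro x hx
    rw [taboo_add, taboo_const_mul, costBefore_eq P y (fun _ => 1) x, mul_add, mul_one, ← add_assoc,
      ← add_assoc, add_comm (g x)]
    exact add_le_add_left ((add_le_add_left (taboo_le_expect P y f x) _).trans (hd x hx)) _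

/-! ### Stationary distributions -/

/-- `occupation P y n z` is the probability that the chain started in `y` is in `z` at time `n`
and not in `y` at any of the times `1, …, n`. -/
noncomputable def occupation (P : S → PMF S) (y : S) : ℕ → S → ℝ≥0∞
  | 0 => ({y} : Set S).indicator 1
  | n + 1 => ({y}ᶜ : Set S).indicator fun z => ∑' x, occupation P y n x * P x z

/-- Duality between measures and functions: occupation sums become costs, for which finiteness is
known. -/
theorem tsum_occupation_mul (P : S → PMF S) (y : S) (n : ℕ) (f : S → ℝ≥0∞) :
    ∑' z, occupation P y n z * f z = (taboo P y)^[n] f y := by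
  induction n generalizing f with
  | zero =>
    rw [tsum_eq_single y]
    · simp [occupation]
    · intro z hz
      simp [occupation, hz]
  | succ n ih =>
    rw [Function.iterate_succ_apply, ← ih]
    have h : ∀ z, occupation P y (n + 1) z * f z =
        ∑' x, occupation P y n x * (P x z * ({y}ᶜ : Set S).indicator f z) := by
      intro z
      by_cases hz : z = y
      · simp [occupation, hz]
      · simp [occupation, hz, ← ENNReal.tsum_mul_right, mul_assoc]
    simp only [h, taboo, expect]
    rw [ENNReal.tsum_comm]
    simp only [ENNReal.tsum_mul_left]

theorem tsum_tsum_occupation_mul (P : S → PMF S) (y : S) (f : S → ℝ≥0∞) :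
    ∑' z, (∑' n, occupation P y n z) * f z = costBefore P y f y := by
  simp only [← ENNReal.tsum_mul_right, costBefore, ← tsum_occupation_mul]
  exact ENNReal.tsum_comm

theorem occupation_eq_zero {P : S → PMF S} {X : Set S} (hX : ∀ x ∈ X, (P x).support ⊆ X) {y : S}
    (hy : y ∈ X) (n : ℕ) {z : S} (hz : z ∉ X) : occupation P y n z = 0 := by
  induction n generalizing z with
  | zero =>
    have : z ≠ y := fun h => hz (h ▸ hy)
    simp [occupation, this]
  | succ n ih =>
    have : z ≠ y := fun h => hz (h ▸ hy)
    simp only [occupation, Set.mem_compl_iff, Set.mem_singleton_iff, this, not_false_eq_true,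
      Set.indicator_of_mem, ENNReal.tsum_eq_zero, mul_eq_zero]
    intro x
    by_cases hx : x ∈ X
    · exact Or.inr (((P x).apply_eq_zero_iff z).2 fun h => hz (hX x hx h))
    · exact Or.inl (ih hx)

/-- The expected visits during an excursion from `y` form an invariant measure whose mass is the
mean return time. Away from `y`, invariance is the recursion of `occupation`; at `y`, it is
certainty of return. -/
theorem exists_stationary {P : S → PMF S} {X : Set S} (hX : ∀ x ∈ X, (P x).support ⊆ X) {y : S}
    (hy : y ∈ X) (hT : costBefore P y (fun _ => 1) y ≠ ∞) :
    ∃ π : PMF S, IsStationaryOn P X π ∧ ∀ f : S → ℝ≥0∞,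
      ∑' x, π x * f x = (costBefore P y (fun _ => 1) y)⁻¹ * costBefore P y f y := by
  set T := costBefore P y (fun _ => 1) y with hTdef
  have hT0 : T ≠ 0 := by
    rw [hTdef, costBefore_eq]
    simp
  set μ : S → ℝ≥0∞ := fun z => ∑' n, occupation P y n z with hμ
  have hmass : ∑' z, μ z = T := by
    have := tsum_tsum_occupation_mul P y (fun _ => 1)
    simpa only [mul_one] using this
  have hinv : ∀ z, ∑' x, μ x * P x z = μ z := by
    intro z
    by_cases hz : z = y
    · have h1 := tsum_tsum_occupation_mul P y (fun x => P x z)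
      subst hz
      rw [h1]
      have h2 : costBefore P z (fun x => P x z) z = 1 := by
        rw [← (isPosRecurrentState_of_costBefore_ne_top hT).1, returnProb_eq]
        rfl
      rw [h2, hμ]
      simp only
      rw [tsum_eq_single 0]
      · simp [occupation]
      · intro n hn
        obtain ⟨k, rfl⟩ := Nat.exists_eq_succ_of_ne_zero hn
        simp [occupation]
    · simp only [hμ, ← ENNReal.tsum_mul_right]
      rw [ENNReal.tsum_comm, tsum_eq_zero_add' (f := fun n => occupation P y n z) ENNReal.summable]
      simp [occupation, hz]
  have hπ : ∀ z, PMF.normalize μ (hmass ▸ hT0) (hmass ▸ hT) z = T⁻¹ * μ z := by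
    intro z
    rw [PMF.normalize_apply, hmass, mul_comm]
  refine ⟨PMF.normalize μ (hmass ▸ hT0) (hmass ▸ hT), ⟨?_, ?_⟩, ?_⟩
  · intro z hz
    by_contra hzX
    rw [PMF.mem_support_normalize_iff] at hz
    exact hz (by simp [hμ, occupation_eq_zero hX hy _ hzX])
  · ext z
    simp only [PMF.bind_apply, hπ, mul_assoc, ENNReal.tsum_mul_left, hinv]
  · intro f
    simp only [hπ, mul_assoc, ENNReal.tsum_mul_left]
    rw [← tsum_tsum_occupation_mul]

theorem eq_zero_of_invariant {P : S → PMF S} {μ : S → ℝ≥0∞}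
    (hinv : ∀ z, ∑' x, μ x * P x z = μ z) {x y : S} (hxy : Accessible P x y) (hy : μ y = 0) :
    μ x = 0 := by
  induction hxy using Relation.ReflTransGen.head_induction_on with
  | refl => exact hy
  | @head a b hab _ ih =>
    have h := hinv b
    rw [ih, ENNReal.tsum_eq_zero] at h
    exact (mul_eq_zero.1 (h a)).resolve_right hab

/-- The pointwise minimum of the two laws is subinvariant, and since a transition preserves its
finite mass it is invariant. Subtract it from the law that attains it at some state of `X`: the
invariant difference vanishes there, hence on all of `X` by irreducibility. So one law lies below
the other, and equal mass makes them equal. -/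
theorem stationary_unique {P : S → PMF S} {X : Set S} (hX : IsIrreducibleOn P X) {π₁ π₂ : PMF S}
    (h₁ : IsStationaryOn P X π₁) (h₂ : IsStationaryOn P X π₂) : π₁ = π₂ := by
  set μ : S → ℝ≥0∞ := fun z => min (π₁ z) (π₂ z) with hμ
  have hinv : ∀ π : PMF S, IsStationaryOn P X π → ∀ z, ∑' x, π x * P x z = π z := by
    intro π h z
    rw [← PMF.bind_apply, h.2]
  have hsub : ∀ z, ∑' x, μ x * P x z ≤ μ z := fun z =>
    le_min ((ENNReal.tsum_le_tsum fun x => mul_le_mul_left (min_le_left _ _) _).trans_eq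
        (hinv π₁ h₁ z))
      ((ENNReal.tsum_le_tsum fun x => mul_le_mul_left (min_le_right _ _) _).trans_eq (hinv π₂ h₂ z))
  have hmass : ∑' z, ∑' x, μ x * P x z = ∑' z, μ z := by
    rw [ENNReal.tsum_comm]
    simp [ENNReal.tsum_mul_left, PMF.tsum_coe]
  have hμtop : ∑' z, μ z ≠ ∞ := ne_top_of_le_ne_top ENNReal.one_ne_top
    ((ENNReal.tsum_le_tsum fun z => min_le_left _ _).trans_eq π₁.tsum_coe)
  have hμinv : ∀ z, ∑' x, μ x * P x z = μ z := by
    intro z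
    refine le_antisymm (hsub z) (not_lt.1 fun hlt => ?_)
    have := ENNReal.tsum_lt_tsum (hmass ▸ hμtop) hsub hlt
    rw [hmass] at this
    exact lt_irrefl _ this
  have hdinv : ∀ π : PMF S, IsStationaryOn P X π → (∀ z, μ z ≤ π z) →
      ∀ z, ∑' x, (π x - μ x) * P x z = π z - μ z := by
    intro π h hle z
    have hz : μ z ≠ ∞ := ne_top_of_le_ne_top (π.apply_ne_top z) (hle z)
    refine ENNReal.eq_sub_of_add_eq hz ?_
    rw [← hinv π h z]
    conv_lhs => rw [← hμinv z]
    rw [← ENNReal.tsum_add]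
    refine tsum_congr fun x => ?_
    rw [← add_mul, tsub_add_cancel_of_le (hle x)]
  have hle : ∀ π π' : PMF S, IsStationaryOn P X π → (∀ z, μ z ≤ π z) → (∀ z, μ z ≤ π' z) →
      (∃ y ∈ X, π y - μ y = 0) → π = π' := by
    rintro π π' h hl hl' ⟨y, hy, hy0⟩
    have hpt : ∀ x, π x ≤ π' x := by
      intro x
      by_cases hx : x ∈ X
      · have := eq_zero_of_invariant (hdinv π h hl) (hX.accessible x hx y hy) hy0
        exact (tsub_eq_zero_iff_le.1 this).trans (hl' x)
      · rw [(π.apply_eq_zero_iff x).2 fun hs => hx (h.1 hs)]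
        exact zero_le
    ext z
    refine le_antisymm (hpt z) (not_lt.1 fun hlt => ?_)
    have := ENNReal.tsum_lt_tsum (by rw [π.tsum_coe]; exact ENNReal.one_ne_top) hpt hlt
    rw [PMF.tsum_coe, PMF.tsum_coe] at this
    exact lt_irrefl _ this
  obtain ⟨y, hy⟩ := hX.nonempty
  rcases min_choice (π₁ y) (π₂ y) with h | h
  · exact hle π₁ π₂ h₁ (fun z => min_le_left _ _) (fun z => min_le_right _ _)
      ⟨y, hy, by simp only [hμ, h, tsub_self]⟩
  · exact (hle π₂ π₁ h₂ (fun z => min_le_right _ _) (fun z => min_le_left _ _)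
      ⟨y, hy, by simp only [hμ, h, tsub_self]⟩).symm

/-- The Foster–Lyapunov criterion: positive recurrence, existence and uniqueness of the stationary
distribution, and finiteness of the stationary mean of the drift. -/
theorem posRecurrent_of_drift {P : S → PMF S} {X : Set S} (hX : IsIrreducibleOn P X)
    {f g : S → ℝ≥0∞} {C : ℝ≥0∞} (hC : C ≠ ∞) (hf : ∀ x ∈ X, f x ≠ ∞)
    (hd : ∀ x ∈ X, expect (P x) f + g x ≤ f x + C)
    (hfin : {x | x ∈ X ∧ g x ≤ C + 1}.Finite) :
    (∀ x ∈ X, IsPosRecurrentState P x) ∧ ∃ π : PMF S, IsStationaryOn P X π ∧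
      (∀ π', IsStationaryOn P X π' → π' = π) ∧ ∑' x, π x * g x ≠ ∞ := by
  refine ⟨fun x hx => isPosRecurrentState_of_costBefore_ne_top
    (costBefore_one_ne_top hX hC hf hd hfin hx x hx), ?_⟩
  obtain ⟨y, hy⟩ := hX.nonempty
  obtain ⟨π, hπ, hπf⟩ := exists_stationary hX.closed hy
    (costBefore_one_ne_top hX hC hf hd hfin hy y hy)
  refine ⟨π, hπ, fun π' hπ' => stationary_unique hX hπ' hπ, ?_⟩
  rw [hπf]
  refine ENNReal.mul_ne_top (ENNReal.inv_ne_top.2 ?_)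
    (costBefore_ne_top hX hC hf hd hfin hy y hy)
  rw [costBefore_eq]
  simp

end MarkovChain

namespace MessageSystem
open MarkovChain

variable {L J : ℕ} (𝓜 : MessageSystem L J)

/-! ### Service quanta -/

theorem S_pos (l : Fin L) : 0 < 𝓜.S l := by
  have h1 : Real.log (𝓜.Pe l) < 0 := Real.log_neg (𝓜.Pe_pos l) (𝓜.Pe_lt_one l)
  have h2 : 0 ≤ Real.log (𝓜.M l) := Real.log_nonneg (by exact_mod_cast 𝓜.M_pos l)
  have h3 := mul_nonneg 𝓜.ρ_pos.le h2
  rw [S]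
  linarith

/-- A scheduled message of class `j` contributes to the total power, so removing `P j` leaves
nonnegative interference and positive effective noise. -/
theorem φ_pos {j : Fin J} {s : Schedule L J} (h : 0 < ∑ l, s (l, j)) : 0 < 𝓜.φ j s := by
  obtain ⟨l, -, hl⟩ : ∃ l ∈ Finset.univ, 0 < s (l, j) := by
    by_contra! hne
    exact h.ne' (Finset.sum_eq_zero fun l hl => Nat.le_zero.1 (hne l hl))
  have h1 : 𝓜.P j ≤ ∑ c : Fin L × Fin J, (s c : ℝ) * 𝓜.P c.2 := by
    refine le_trans ?_ (Finset.single_le_sum (f := fun c : Fin L × Fin J => (s c : ℝ) * 𝓜.P c.2)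
      (fun c _ => mul_nonneg (Nat.cast_nonneg _) (𝓜.P_pos _).le) (Finset.mem_univ (l, j)))
    exact le_mul_of_one_le_left (𝓜.P_pos j).le (by exact_mod_cast hl)
  have h2 : 0 < 𝓜.N₀ * 𝓜.W := mul_pos 𝓜.N₀_pos 𝓜.W_pos
  have hρ := 𝓜.ρ_pos
  have hP := 𝓜.P_pos j
  rw [φ, if_pos h]
  refine mul_pos hρ (Real.log_pos ?_)
  have : 0 < (1 + 𝓜.ρ) *
      (𝓜.N₀ * 𝓜.W + ((∑ c : Fin L × Fin J, (s c : ℝ) * 𝓜.P c.2) - 𝓜.P j)) :=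
    mul_pos (by linarith) (by linarith)
  have := div_pos hP this
  linarith

theorem φ_nonneg (j : Fin J) (s : Schedule L J) : 0 ≤ 𝓜.φ j s := by
  by_cases h : 0 < ∑ l, s (l, j)
  · exact (𝓜.φ_pos h).le
  · rw [φ, if_neg h]

theorem finite_schedules_le (L J K : ℕ) : {s : Schedule L J | ∑ c, s c ≤ K}.Finite := by
  refine (Set.finite_Iic (fun _ : Fin L × Fin J => K)).subset fun s hs c => ?_
  exact (Finset.single_le_sum (f := s) (fun _ _ => Nat.zero_le _) (Finset.mem_univ c)).trans hs

theorem finite_fullSchedules (L J K : ℕ) : (fullSchedules L J K).Finite :=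
  (finite_schedules_le L J K).subset fun _ hs => le_of_eq hs

theorem finite_fullSchedulesAt (L J K : ℕ) (j : Fin J) : (fullSchedulesAt L J K j).Finite :=
  (finite_fullSchedules L J K).subset fun _ hs => hs.1

theorem fullSchedulesAt_nonempty (hL : 0 < L) {K : ℕ} (hK : 0 < K) (j : Fin J) :
    (fullSchedulesAt L J K j).Nonempty := by
  classical
  refine ⟨Pi.single (⟨0, hL⟩, j) K, ?_, ?_⟩
  · simp [fullSchedules]
  · refine lt_of_lt_of_le ?_ (Finset.single_le_sum
      (f := fun l => (Pi.single (⟨0, hL⟩, j) K : Schedule L J) (l, j))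
      (fun _ _ => Nat.zero_le _) (Finset.mem_univ ⟨0, hL⟩))
    simpa using hK

theorem φmin_le {K : ℕ} {j : Fin J} {s : Schedule L J} (hs : s ∈ fullSchedulesAt L J K j) :
    𝓜.φmin K j ≤ 𝓜.φ j s :=
  csInf_le ((finite_fullSchedulesAt L J K j).image _).bddBelow (Set.mem_image_of_mem _ hs)

theorem le_φmax {K : ℕ} {j : Fin J} {s : Schedule L J} (hs : s ∈ fullSchedulesAt L J K j) :
    𝓜.φ j s ≤ 𝓜.φmax K j :=
  le_csSup ((finite_fullSchedulesAt L J K j).image _).bddAbove (Set.mem_image_of_mem _ hs)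

theorem φmin_pos {K : ℕ} (hK : 0 < K) (j : Fin J) : 0 < 𝓜.φmin K j := by
  obtain ⟨s, hs, h⟩ := ((fullSchedulesAt_nonempty 𝓜.L_pos hK j).image (𝓜.φ j)).csInf_mem
    ((finite_fullSchedulesAt L J K j).image _)
  rw [φmin, ← h]
  exact 𝓜.φ_pos hs.2

theorem φmax_pos {K : ℕ} (hK : 0 < K) (j : Fin J) : 0 < 𝓜.φmax K j := by
  obtain ⟨s, hs⟩ := fullSchedulesAt_nonempty (J := J) 𝓜.L_pos hK j
  exact (𝓜.φ_pos hs.2).trans_le (𝓜.le_φmax hs)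

theorem φtot_le {K : ℕ} {s : Schedule L J} (hs : s ∈ fullSchedules L J K) :
    𝓜.φtot K ≤ 𝓜.totalQuantum Finset.univ s :=
  csInf_le ((finite_fullSchedules L J K).image _).bddBelow (Set.mem_image_of_mem _ hs)

theorem le_maxQuantum {K : ℕ} (B : Finset (Fin J)) {s : Schedule L J}
    (hs : s ∈ fullSchedules L J K) : 𝓜.totalQuantum B s ≤ 𝓜.maxQuantum K B :=
  le_csSup ((finite_fullSchedules L J K).image _).bddAbove (Set.mem_image_of_mem _ hs)

/-! ### Scheduling -/

theorem sum_scheduleOf (α : SysState L J) (T : Finset (Fin α.length)) (f : Fin L × Fin J → ℝ) :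
    ∑ k ∈ T, f ((α.get k).l, (α.get k).j) = ∑ c, (scheduleOf α T c : ℝ) * f c := by
  rw [← Finset.sum_fiberwise T (fun k => ((α.get k).l, (α.get k).j))]
  refine Finset.sum_congr rfl fun c _ => ?_
  rw [Finset.sum_congr rfl (g := fun _ => f c)
    (fun k hk => by rw [(Finset.mem_filter.1 hk).2]), Finset.sum_const, nsmul_eq_mul, scheduleOf]
  simp only [Prod.ext_iff]

theorem sum_scheduleOf_eq_card (α : SysState L J) (T : Finset (Fin α.length)) :
    ∑ c, scheduleOf α T c = T.card := by
  have h := sum_scheduleOf α T fun _ => 1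
  simp only [Finset.sum_const, nsmul_eq_mul, mul_one] at h
  exact_mod_cast h.symm

theorem sum_scheduleOf_pos {α : SysState L J} {T : Finset (Fin α.length)} {k : Fin α.length}
    (hk : k ∈ T) : 0 < ∑ l, scheduleOf α T (l, (α.get k).j) := by
  refine lt_of_lt_of_le ?_ (Finset.single_le_sum
    (f := fun l => scheduleOf α T (l, (α.get k).j)) (fun _ _ => Nat.zero_le _)
    (Finset.mem_univ (α.get k).l))
  exact Finset.card_pos.2 ⟨k, Finset.mem_filter.2 ⟨hk, rfl, rfl⟩⟩

theorem sum_quantum_eq (B : Finset (Fin J)) (α : SysState L J) (T : Finset (Fin α.length)) :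
    ∑ k ∈ T, (if (α.get k).j ∈ B then 𝓜.φ (α.get k).j (scheduleOf α T) else 0) =
      𝓜.totalQuantum B (scheduleOf α T) := by
  rw [sum_scheduleOf α T fun c => if c.2 ∈ B then 𝓜.φ c.2 (scheduleOf α T) else 0,
    Fintype.sum_prod_type, totalQuantum]
  refine Finset.sum_congr rfl fun l _ => ?_
  simp only [mul_ite, mul_zero]
  rw [← Finset.sum_filter]
  simp

/-! ### Additive functions of the state -/

/-- The total weight of the messages of a state, where a message of power class `j` with residual
requirement `r` has weight `w j r`. -/
noncomputable def weight (w : Fin J → ℝ → ℝ) (α : SysState L J) : ℝ :=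
  (α.map fun m => w m.j m.residual).sum

theorem weight_append (w : Fin J → ℝ → ℝ) (α β : SysState L J) :
    weight w (α ++ β) = weight w α + weight w β := by
  simp [weight]

theorem weight_eq_sum (w : Fin J → ℝ → ℝ) (α : SysState L J) :
    weight w α = ∑ k : Fin α.length, w (α.get k).j (α.get k).residual := by
  rw [weight]
  conv_lhs => rw [← List.ofFn_get α, List.map_ofFn, List.sum_ofFn]
  rfl

theorem weight_newMessages (w : Fin J → ℝ → ℝ) (a : Schedule L J) :
    weight w (𝓜.newMessages a) = ∑ l, ∑ j, (a (l, j) : ℝ) * w j (𝓜.S l) := by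
  simp only [weight, newMessages, List.flatMap_def, List.map_flatten,
    List.map_replicate, List.sum_flatten, List.map_map, Function.comp_def, List.sum_replicate, nsmul_eq_mul,
    Fin.sum_univ_def]

theorem sum_map_filterMap {ι κ : Type*} (g : κ → ℝ) (f : ι → Option κ) (l : List ι) :
    ((l.filterMap f).map g).sum = (l.map fun i => (f i).elim 0 g).sum := by
  induction l with
  | nil => rfl
  | cons i l ih =>
    rw [List.map_cons, List.sum_cons, ← ih, List.filterMap_cons]
    cases f i <;> simp

/-- Since `w` vanishes at nonpositive residuals, a departing message may be treated as kept with
residual `r - φ ≤ 0`, so departures and reductions obey one formula. -/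
theorem weight_serve {w : Fin J → ℝ → ℝ} (hw : ∀ j r, r ≤ 0 → w j r = 0) (α : SysState L J)
    (T : Finset (Fin α.length)) :
    weight w (𝓜.serve α T) + ∑ k ∈ T, (w (α.get k).j (α.get k).residual -
      w (α.get k).j ((α.get k).residual - 𝓜.φ (α.get k).j (scheduleOf α T))) = weight w α := by
  rw [weight, serve, sum_map_filterMap, ← Fin.sum_univ_def, weight_eq_sum,
    ← Finset.sum_filter_add_sum_filter_not Finset.univ (fun k => k ∈ T),
    ← Finset.sum_filter_add_sum_filter_not Finset.univ (fun k => k ∈ T)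
      (fun k => w (α.get k).j (α.get k).residual)]
  have h1 : Finset.univ.filter (fun k => k ∈ T) = T := by simp
  rw [h1, add_right_comm, ← Finset.sum_add_distrib]
  congr 1
  · refine Finset.sum_congr rfl fun k hk => ?_
    simp only [hk, if_true]
    by_cases hr : (α.get k).residual ≤ 𝓜.φ (α.get k).j (scheduleOf α T)
    · rw [if_pos hr, hw _ _ (sub_nonpos.2 hr)]
      simp
    · rw [if_neg hr]
      simp
  · refine Finset.sum_congr rfl fun k hk => ?_
    simp only [(Finset.mem_filter.1 hk).2, if_false, Option.elim_some]

theorem mem_serve {α : SysState L J} {T : Finset (Fin α.length)} {m : Message L J}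
    (hm : m ∈ 𝓜.serve α T) : m ∈ α ∨ ∃ k ∈ T,
      𝓜.φ (α.get k).j (scheduleOf α T) < (α.get k).residual ∧
      m = { α.get k with
        residual := (α.get k).residual - 𝓜.φ (α.get k).j (scheduleOf α T) } := by
  simp only [serve, List.mem_filterMap] at hm
  obtain ⟨k, -, hk⟩ := hm
  by_cases hT : k ∈ T
  · rw [if_pos hT] at hk
    by_cases hr : (α.get k).residual ≤ 𝓜.φ (α.get k).j (scheduleOf α T)
    · rw [if_pos hr] at hk
      exact absurd hk (by simp)
    · rw [if_neg hr, Option.some_inj] at hk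
      exact Or.inr ⟨k, hT, not_le.1 hr, hk.symm⟩
  · rw [if_neg hT, Option.some_inj] at hk
    exact Or.inl (hk ▸ List.get_mem α k)

theorem mem_newMessages {a : Schedule L J} {m : Message L J} (hm : m ∈ 𝓜.newMessages a) :
    m.residual = 𝓜.S m.l := by
  simp only [newMessages, List.mem_flatMap, List.mem_replicate] at hm
  obtain ⟨l, -, j, -, -, rfl⟩ := hm
  rfl

variable {𝓜} in
theorem Admissible.serve_append {α : SysState L J} (hα : 𝓜.Admissible α)
    (T : Finset (Fin α.length)) (a : Schedule L J) :
    𝓜.Admissible (𝓜.serve α T ++ 𝓜.newMessages a) := by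
  intro m hm
  rcases List.mem_append.1 hm with hm | hm
  · rcases 𝓜.mem_serve hm with hm | ⟨k, _, hr, rfl⟩
    · exact hα m hm
    · have h1 := hα _ (List.get_mem α k)
      have h2 := 𝓜.φ_nonneg (α.get k).j (scheduleOf α T)
      exact ⟨sub_pos.2 hr, by simp only; linarith⟩
  · rw [𝓜.mem_newMessages hm]
    exact ⟨𝓜.S_pos _, le_rfl⟩

theorem mem_support_transition {K : ℕ} {ω : NonIdlingPolicy L J K} {α β : SysState L J} :
    β ∈ (𝓜.transition ω α).support ↔ ∃ T ∈ (ω.select α).support, ∃ a ∈ 𝓜.arrivals.support,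
      𝓜.serve α T ++ 𝓜.newMessages a = β := by
  simp only [transition, PMF.mem_support_bind_iff, PMF.support_map, Set.mem_image]

variable {𝓜} in
theorem Admissible.of_accessible {K : ℕ} {ω : NonIdlingPolicy L J K} {α β : SysState L J}
    (hα : 𝓜.Admissible α) (h : Accessible (𝓜.transition ω) α β) : 𝓜.Admissible β := by
  induction h with
  | refl => exact hα
  | tail _ hz ih =>
    obtain ⟨T, -, a, -, rfl⟩ := (mem_support_transition 𝓜).1 hz
    exact ih.serve_append T a

theorem expect_transition {K : ℕ} (ω : NonIdlingPolicy L J K) (α : SysState L J)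
    (f : SysState L J → ℝ≥0∞) : expect (𝓜.transition ω α) f =
      expect (ω.select α) fun T => expect 𝓜.arrivals fun a =>
        f (𝓜.serve α T ++ 𝓜.newMessages a) := by
  simp only [transition, expect_bind, expect_map, Function.comp_def]

/-- A bound valid for each selectable set survives any randomization among them. -/
theorem expect_transition_le {K : ℕ} (ω : NonIdlingPolicy L J K) (α : SysState L J)
    (f : SysState L J → ℝ≥0∞) (c : ℝ≥0∞)
    (h : ∀ T ∈ (ω.select α).support, expect 𝓜.arrivals
      (fun a => f (𝓜.serve α T ++ 𝓜.newMessages a)) ≤ c) :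
    expect (𝓜.transition ω α) f ≤ c := by
  rw [expect_transition]
  exact (expect_mono h).trans_eq (expect_const _ _)

/-! ### Arrivals -/

theorem expect_arrivals (c : Fin L × Fin J) (g : ℕ → ℝ≥0∞) :
    expect 𝓜.arrivals (fun a => g (a c)) = expect (𝓜.p c.1 c.2) g := by
  have h1 : expect 𝓜.arrivals (fun a => g (a c)) = ∫⁻ a, g (a c)
      ∂(MeasureTheory.Measure.pi fun c : Fin L × Fin J => (𝓜.p c.1 c.2).toMeasure) := by
    rw [MeasureTheory.lintegral_countable', expect]
    simp only [arrivals, MeasureTheory.Measure.toPMF_apply, mul_comm]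
  have h2 : expect (𝓜.p c.1 c.2) g = ∫⁻ k, g k ∂(𝓜.p c.1 c.2).toMeasure := by
    rw [MeasureTheory.lintegral_countable', expect]
    simp only [PMF.toMeasure_apply_singleton _ _ (measurableSet_singleton _), mul_comm]
  rw [h1, h2]
  exact (MeasureTheory.measurePreserving_eval
    (fun c : Fin L × Fin J => (𝓜.p c.1 c.2).toMeasure) c).lintegral_comp
    (measurable_of_countable g)

theorem meanA_nonneg (l : Fin L) (j : Fin J) : 0 ≤ 𝓜.meanA l j :=
  tsum_nonneg fun _ => mul_nonneg ENNReal.toReal_nonneg (Nat.cast_nonneg _)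

theorem ofReal_meanA (l : Fin L) (j : Fin J) :
    ENNReal.ofReal (𝓜.meanA l j) = expect (𝓜.p l j) fun k => (k : ℝ≥0∞) := by
  have h : 𝓜.meanA l j = (expect (𝓜.p l j) fun k => (k : ℝ≥0∞)).toReal := by
    rw [expect, ENNReal.tsum_toReal_eq, meanA]
    · simp only [ENNReal.toReal_mul, ENNReal.toReal_natCast]
    · exact fun k => ENNReal.mul_ne_top ((𝓜.p l j).apply_ne_top k) (ENNReal.natCast_ne_top k)
  rw [h, ENNReal.ofReal_toReal]
  refine ne_top_of_le_ne_top (𝓜.second_moment l j).ne (expect_mono fun k _ => ?_)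
  rw [← Nat.cast_pow]
  exact Nat.cast_le.2 (Nat.le_self_pow two_ne_zero k)

theorem expect_finset_sum {R ι : Type*} (p : PMF R) (s : Finset ι) (f : ι → R → ℝ≥0∞) :
    expect p (fun x => ∑ i ∈ s, f i x) = ∑ i ∈ s, expect p (f i) := by
  classical
  induction s using Finset.induction_on with
  | empty => simp [expect]
  | insert i s hi ih => simp only [Finset.sum_insert hi, expect_add, ih]

theorem expect_arrivals_linear {v : Fin L → Fin J → ℝ} (hv : ∀ l j, 0 ≤ v l j) :
    expect 𝓜.arrivals (fun a => ENNReal.ofReal (∑ l, ∑ j, (a (l, j) : ℝ) * v l j)) =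
      ENNReal.ofReal (∑ l, ∑ j, 𝓜.meanA l j * v l j) := by
  have h1 : ∀ b : Fin L → Fin J → ℝ, (∀ l j, 0 ≤ b l j) →
      ENNReal.ofReal (∑ l, ∑ j, b l j * v l j) =
      ∑ l, ∑ j, ENNReal.ofReal (v l j) * ENNReal.ofReal (b l j) := by
    intro b hb
    rw [ENNReal.ofReal_sum_of_nonneg
      fun l _ => Finset.sum_nonneg fun j _ => mul_nonneg (hb l j) (hv l j)]
    refine Finset.sum_congr rfl fun l _ => ?_
    rw [ENNReal.ofReal_sum_of_nonneg fun j _ => mul_nonneg (hb l j) (hv l j)]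
    refine Finset.sum_congr rfl fun j _ => ?_
    rw [mul_comm, ENNReal.ofReal_mul (hv l j)]
  rw [h1 _ 𝓜.meanA_nonneg]
  simp only [fun a : Schedule L J => h1 (fun l j => (a (l, j) : ℝ)) fun _ _ => Nat.cast_nonneg _,
    expect_finset_sum, expect_const_mul, ENNReal.ofReal_natCast, ofReal_meanA,
    fun l j => 𝓜.expect_arrivals (l, j) fun k => (k : ℝ≥0∞)]

theorem expect_arrivals_sq_ne_top (v : Fin L → Fin J → ℝ) :
    expect 𝓜.arrivals (fun a => ENNReal.ofReal ((∑ l, ∑ j, (a (l, j) : ℝ) * v l j) ^ 2)) ≠ ∞ := by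
  have h1 : ∀ a : Schedule L J, ENNReal.ofReal ((∑ l, ∑ j, (a (l, j) : ℝ) * v l j) ^ 2) ≤
      ∑ c : Fin L × Fin J, ENNReal.ofReal (∑ c : Fin L × Fin J, v c.1 c.2 ^ 2) *
        (a c : ℝ≥0∞) ^ 2 := by
    intro a
    rw [← Finset.mul_sum, ← Fintype.sum_prod_type' (f := fun l j => (a (l, j) : ℝ) * v l j)]
    -- Cauchy–Schwarz over the classes reduces the claim to second moments of single counts.
    refine (ENNReal.ofReal_le_ofReal (Finset.sum_mul_sq_le_sq_mul_sq _ _ _)).trans_eq ?_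
    rw [mul_comm, ENNReal.ofReal_mul (Finset.sum_nonneg fun _ _ => sq_nonneg _)]
    congr 1
    rw [ENNReal.ofReal_sum_of_nonneg fun _ _ => sq_nonneg _]
    refine Finset.sum_congr rfl fun c _ => ?_
    rw [ENNReal.ofReal_pow (Nat.cast_nonneg _), ENNReal.ofReal_natCast]
  refine ne_top_of_le_ne_top ?_ (expect_mono fun a _ => h1 a)
  rw [expect_finset_sum]
  refine ENNReal.sum_ne_top.2 fun c _ => ?_
  rw [expect_const_mul, 𝓜.expect_arrivals c fun k => (k : ℝ≥0∞) ^ 2]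
  exact ENNReal.mul_ne_top ENNReal.ofReal_ne_top (𝓜.second_moment c.1 c.2).ne

end MessageSystem

/-! ### Additive monoids generated by positive reals -/

/-- A finite set of positive reals generates an additive monoid with finite initial segments. -/
theorem AddSubmonoid.finite_closure_le {G : Set ℝ} (hG : G.Finite) (hpos : ∀ g ∈ G, 0 < g)
    (M : ℝ) : {x | x ∈ AddSubmonoid.closure G ∧ x ≤ M}.Finite := by
  classical
  lift G to Finset ℝ using hG
  refine ((Set.finite_Iic (fun g : G => ⌊M / g⌋₊)).image
    fun n => ∑ g : G, n g • (g : ℝ)).subset ?_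
  rintro x ⟨hx, hxM⟩
  obtain ⟨n, -, rfl⟩ := AddSubmonoid.mem_closure_finset.1 hx
  refine ⟨fun g => n g, fun g => ?_, Finset.sum_coe_sort G fun g => n g • g⟩
  refine Nat.le_floor ((le_div_iff₀ (hpos g g.2)).2 (le_trans ?_ hxM))
  rw [← nsmul_eq_mul]
  exact Finset.single_le_sum (f := fun g => n g • g)
    (fun g hg => nsmul_nonneg (hpos g hg).le _) g.2

theorem AddSubmonoid.nonneg_of_mem_closure {G : Set ℝ} (hpos : ∀ g ∈ G, 0 < g) {x : ℝ}
    (hx : x ∈ AddSubmonoid.closure G) : 0 ≤ x := by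
  induction hx using AddSubmonoid.closure_induction with
  | mem x hx => exact (hpos x hx).le
  | zero => exact le_rfl
  | add x y _ _ hx hy => exact add_nonneg hx hy

namespace MessageSystem
open MarkovChain

variable {L J : ℕ} (𝓜 : MessageSystem L J)

/-! ### Finiteness of the accessible states with boundedly many messages -/

/-- The quanta that schedules of at most `K` messages offer to the messages they contain. -/
def quanta (K : ℕ) : Set ℝ :=
  (fun x : Fin J × Schedule L J => 𝓜.φ x.1 x.2) '' {x | ∑ c, x.2 c ≤ K ∧ 0 < ∑ l, x.2 (l, x.1)}

theorem finite_quanta (K : ℕ) : (𝓜.quanta K).Finite :=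
  ((Set.finite_univ.prod (finite_schedules_le L J K)).subset
    fun _ hx => ⟨Set.mem_univ _, hx.1⟩).image _

theorem quanta_pos {K : ℕ} {q : ℝ} (hq : q ∈ 𝓜.quanta K) : 0 < q := by
  obtain ⟨x, hx, rfl⟩ := hq
  exact 𝓜.φ_pos hx.2

/-- A residual is an initial value, old or new, minus the quanta received. States with fewer than
`K` messages occur on the way, so `quanta` must include non-full schedules. -/
theorem residual_of_accessible {K : ℕ} {ω : NonIdlingPolicy L J K} {α β : SysState L J}
    (h : Accessible (𝓜.transition ω) α β) {m : Message L J} (hm : m ∈ β) :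
    ∃ b ∈ Message.residual '' {m | m ∈ α} ∪ Set.range 𝓜.S,
      ∃ t ∈ AddSubmonoid.closure (𝓜.quanta K), m.residual = b - t := by
  induction h generalizing m with
  | refl => exact ⟨_, Or.inl ⟨m, hm, rfl⟩, 0, zero_mem _, (sub_zero _).symm⟩
  | @tail γ _ _ hz ih =>
    obtain ⟨T, hT, a, -, rfl⟩ := (mem_support_transition 𝓜).1 hz
    rcases List.mem_append.1 hm with hm | hm
    · rcases 𝓜.mem_serve hm with hm | ⟨k, hk, -, rfl⟩
      · exact ih hm
      · obtain ⟨b, hb, t, ht, hr⟩ := ih (List.get_mem _ k)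
        refine ⟨b, hb, t + _, add_mem ht (AddSubmonoid.subset_closure
          ⟨((γ.get k).j, scheduleOf γ T), ⟨?_, sum_scheduleOf_pos hk⟩, rfl⟩), ?_⟩
        · rw [sum_scheduleOf_eq_card, ω.nonIdling _ T hT]
          exact min_le_right _ _
        · simp only
          rw [hr]
          ring
    · exact ⟨_, Or.inr ⟨m.l, rfl⟩, 0, zero_mem _, by rw [𝓜.mem_newMessages hm, sub_zero]⟩

/-- Positive residuals bound the service already received by the largest initial value `M`. The
possible totals of quanta up to `M` are finitely many, hence so are the possible messages. -/
theorem finite_accessible_length_le {K : ℕ} (ω : NonIdlingPolicy L J K) {α : SysState L J}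
    (hα : 𝓜.Admissible α) (n : ℕ) :
    {β | Accessible (𝓜.transition ω) α β ∧ β.length ≤ n}.Finite := by
  set b₀ : Set ℝ := Message.residual '' {m | m ∈ α} ∪ Set.range 𝓜.S with hb₀
  have hb₀fin : b₀.Finite := ((List.finite_toSet α).image _).union (Set.finite_range _)
  obtain ⟨M, hM⟩ := hb₀fin.bddAbove
  set R : Set ℝ := Set.image2 (fun b t => b - t) b₀
    {t | t ∈ AddSubmonoid.closure (𝓜.quanta K) ∧ t ≤ M} with hR
  have hRfin : R.Finite := hb₀fin.image2 _
    (AddSubmonoid.finite_closure_le (𝓜.finite_quanta K) (fun _ => 𝓜.quanta_pos) M)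
  set A : Set (Message L J) := (fun x : ℝ × Fin L × Fin J => ⟨x.1, x.2.1, x.2.2⟩) ''
    (R ×ˢ Set.univ) with hA
  have hAfin : A.Finite := (hRfin.prod Set.finite_univ).image _
  have : Finite A := hAfin
  refine ((List.finite_length_le A n).image (List.map Subtype.val)).subset ?_
  rintro β ⟨hβ, hn⟩
  have hmem : ∀ m ∈ β, m ∈ A := by
    intro m hm
    obtain ⟨b, hb, t, ht, hr⟩ := 𝓜.residual_of_accessible hβ hm
    have hpos := ((hα.of_accessible hβ) m hm).1
    refine ⟨(m.residual, m.l, m.j), ⟨⟨b, hb, t, ⟨ht, ?_⟩, hr.symm⟩, Set.mem_univ _⟩, rfl⟩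
    have := hM hb
    linarith
  lift β to List A using hmem
  exact ⟨β, by simpa using hn, rfl⟩

/-! ### Monotone weights -/

/-- Weights that increase with the residual requirement and vanish when it is exhausted. -/
structure IsWeight (w : Fin J → ℝ → ℝ) : Prop where
  mono : ∀ j, Monotone (w j)
  zero : ∀ j r, r ≤ 0 → w j r = 0

/-- The weight that is worked off when the messages at the positions in `T` are served. -/
noncomputable def decrease (w : Fin J → ℝ → ℝ) (α : SysState L J) (T : Finset (Fin α.length)) :
    ℝ :=
  ∑ k ∈ T, (w (α.get k).j (α.get k).residual -
    w (α.get k).j ((α.get k).residual - 𝓜.φ (α.get k).j (scheduleOf α T)))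

/-- The mean weight of the messages that arrive in a slot. -/
noncomputable def meanLoad (w : Fin J → ℝ → ℝ) : ℝ := ∑ l, ∑ j, 𝓜.meanA l j * w j (𝓜.S l)

/-- The weight of an arrival vector. -/
noncomputable def load (w : Fin J → ℝ → ℝ) (a : Schedule L J) : ℝ :=
  ∑ l, ∑ j, (a (l, j) : ℝ) * w j (𝓜.S l)

namespace IsWeight

variable {𝓜} {w : Fin J → ℝ → ℝ}

theorem nonneg (hw : IsWeight w) (j : Fin J) (r : ℝ) : 0 ≤ w j r := by
  rw [← hw.zero j (min r 0) (min_le_right _ _)]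
  exact hw.mono j (min_le_left _ _)

theorem weight_nonneg (hw : IsWeight w) (α : SysState L J) : 0 ≤ weight w α :=
  List.sum_nonneg fun x hx => by
    obtain ⟨m, -, rfl⟩ := List.mem_map.1 hx
    exact hw.nonneg _ _

theorem load_nonneg (hw : IsWeight w) (a : Schedule L J) : 0 ≤ 𝓜.load w a :=
  Finset.sum_nonneg fun _ _ => Finset.sum_nonneg fun _ _ =>
    mul_nonneg (Nat.cast_nonneg _) (hw.nonneg _ _)

theorem meanLoad_nonneg (hw : IsWeight w) : 0 ≤ 𝓜.meanLoad w :=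
  Finset.sum_nonneg fun _ _ => Finset.sum_nonneg fun _ _ =>
    mul_nonneg (𝓜.meanA_nonneg _ _) (hw.nonneg _ _)

theorem decrease_nonneg (hw : IsWeight w) (α : SysState L J) (T : Finset (Fin α.length)) :
    0 ≤ 𝓜.decrease w α T :=
  Finset.sum_nonneg fun _ _ => sub_nonneg.2 (hw.mono _ (sub_le_self _ (𝓜.φ_nonneg _ _)))

theorem weight_serve_append (w : Fin J → ℝ → ℝ) (α : SysState L J) (T : Finset (Fin α.length))
    (a : Schedule L J) : weight w (𝓜.serve α T ++ 𝓜.newMessages a) =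
      weight w (𝓜.serve α T) + 𝓜.load w a := by
  rw [weight_append, weight_newMessages, load]

theorem weight_serve_eq (hw : IsWeight w) (α : SysState L J) (T : Finset (Fin α.length)) :
    weight w (𝓜.serve α T) = weight w α - 𝓜.decrease w α T :=
  eq_sub_of_add_eq (𝓜.weight_serve hw.zero α T)

theorem weight_le (hw : IsWeight w) {α : SysState L J} (hα : 𝓜.Admissible α) :
    weight w α ≤ α.length * ∑ l, ∑ j, w j (𝓜.S l) := by
  rw [weight, ← nsmul_eq_mul, ← List.length_map (fun m : Message L J => w m.j m.residual)]
  refine List.sum_le_card_nsmul _ _ fun x hx => ?_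
  obtain ⟨m, hm, rfl⟩ := List.mem_map.1 hx
  calc w m.j m.residual ≤ w m.j (𝓜.S m.l) := hw.mono _ (hα m hm).2
    _ ≤ ∑ j, w j (𝓜.S m.l) := Finset.single_le_sum (f := fun j => w j (𝓜.S m.l))
        (fun j _ => hw.nonneg _ _) (Finset.mem_univ m.j)
    _ ≤ _ := Finset.single_le_sum (f := fun l => ∑ j, w j (𝓜.S l))
        (fun l _ => Finset.sum_nonneg fun j _ => hw.nonneg _ _) (Finset.mem_univ m.l)

theorem weight_le_of_length_lt (hw : IsWeight w) {α : SysState L J} (hα : 𝓜.Admissible α) {K : ℕ}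
    (h : α.length < K) : weight w α ≤ K * ∑ l, ∑ j, w j (𝓜.S l) :=
  (hw.weight_le hα).trans (mul_le_mul_of_nonneg_right (Nat.cast_le.2 h.le)
    (Finset.sum_nonneg fun _ _ => Finset.sum_nonneg fun _ _ => hw.nonneg _ _))

theorem length_mul_le_weight {c : ℝ} (hc : ∀ j r, 0 < r → c ≤ w j r) {α : SysState L J}
    (hα : 𝓜.Admissible α) : α.length * c ≤ weight w α := by
  rw [weight, ← nsmul_eq_mul, ← List.length_map (fun m : Message L J => w m.j m.residual)]
  refine List.card_nsmul_le_sum _ _ fun x hx => ?_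
  obtain ⟨m, hm, rfl⟩ := List.mem_map.1 hx
  exact hc _ _ (hα m hm).1

theorem expect_load (hw : IsWeight w) :
    expect 𝓜.arrivals (fun a => ENNReal.ofReal (𝓜.load w a)) =
      ENNReal.ofReal (𝓜.meanLoad w) :=
  𝓜.expect_arrivals_linear fun _ _ => hw.nonneg _ _

end IsWeight

/-- The second moment of the weight of the messages that arrive in a slot. -/
noncomputable def secondMomentLoad (w : Fin J → ℝ → ℝ) : ℝ :=
  (expect 𝓜.arrivals fun a => ENNReal.ofReal (𝓜.load w a ^ 2)).toReal

theorem secondMomentLoad_nonneg (w : Fin J → ℝ → ℝ) : 0 ≤ 𝓜.secondMomentLoad w :=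
  ENNReal.toReal_nonneg

theorem expect_load_sq (w : Fin J → ℝ → ℝ) :
    expect 𝓜.arrivals (fun a => ENNReal.ofReal (𝓜.load w a ^ 2)) =
      ENNReal.ofReal (𝓜.secondMomentLoad w) :=
  (ENNReal.ofReal_toReal (𝓜.expect_arrivals_sq_ne_top fun l j => w j (𝓜.S l))).symm

/-- This is `weight_serve` for the weight that counts messages: each served one loses at most one.
-/
theorem length_le_length_serve {α : SysState L J} (hα : 𝓜.Admissible α)
    (T : Finset (Fin α.length)) : α.length ≤ (𝓜.serve α T).length + T.card := by
  classical
  set w : Fin J → ℝ → ℝ := fun _ r => if 0 < r then 1 else 0 with hwdef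
  have h1 : ∀ r : ℝ, (if 0 < r then 1 else 0 : ℝ) ≤ 1 := fun r => by split_ifs <;> norm_num
  have h0 : ∀ r : ℝ, (0 : ℝ) ≤ if 0 < r then 1 else 0 := fun r => by split_ifs <;> norm_num
  have hs := 𝓜.weight_serve (w := w) (fun j r hr => if_neg (not_lt.2 hr)) α T
  have hα1 : (α.length : ℝ) * 1 ≤ weight w α :=
    IsWeight.length_mul_le_weight (fun j r hr => by simp [hwdef, hr]) hα
  have hβ : ∀ β : SysState L J, weight w β ≤ β.length := by
    intro β
    rw [weight]
    refine (List.sum_le_card_nsmul _ 1 fun x hx => ?_).trans_eq (by simp)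
    obtain ⟨m, -, rfl⟩ := List.mem_map.1 hx
    exact h1 _
  have hT : 𝓜.decrease w α T ≤ T.card := by
    refine (Finset.sum_le_card_nsmul _ _ 1 fun k _ => ?_).trans_eq (by simp)
    have := h1 (α.get k).residual
    have := h0 ((α.get k).residual - 𝓜.φ (α.get k).j (scheduleOf α T))
    simp only [hwdef]
    linarith
  have h2 := hβ (𝓜.serve α T)
  rw [decrease] at hT
  have : (α.length : ℝ) ≤ (𝓜.serve α T).length + T.card := by linarith
  exact_mod_cast this

/-! ### Stability -/

/-- If a monotone weight is worked off, in all states with at least `K` messages, at a greater rate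
than it arrives, then the square of the weight is a Lyapunov function. -/
theorem expect_sq_weight_add_le {K : ℕ} (ω : NonIdlingPolicy L J K) {w : Fin J → ℝ → ℝ}
    (hw : IsWeight w) {D : ℝ} (hD : ∀ α : SysState L J, 𝓜.Admissible α →
      ∀ T : Finset (Fin α.length), T.card = K → D ≤ 𝓜.decrease w α T)
    (hm : 𝓜.meanLoad w < D) :
    ∃ C : ℝ, ∀ α, 𝓜.Admissible α →
      expect (𝓜.transition ω α) (fun β => ENNReal.ofReal (weight w β ^ 2)) +
        ENNReal.ofReal (2 * (D - 𝓜.meanLoad w) * weight w α) ≤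
      ENNReal.ofReal (weight w α ^ 2) + ENNReal.ofReal C := by
  set m := 𝓜.meanLoad w with hmdef
  set m₂ := 𝓜.secondMomentLoad w with hm₂def
  set v := (K : ℝ) * ∑ l, ∑ j, w j (𝓜.S l) with hv
  have hm0 : 0 ≤ m := hw.meanLoad_nonneg
  have hm₂0 : 0 ≤ m₂ := 𝓜.secondMomentLoad_nonneg w
  have hv0 : 0 ≤ v := mul_nonneg (Nat.cast_nonneg _)
    (Finset.sum_nonneg fun _ _ => Finset.sum_nonneg fun _ _ => hw.nonneg _ _)
  have hD0 : 0 < D := hm0.trans_lt hm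
  have hC : 0 ≤ D ^ 2 + m₂ + 2 * D * v := by positivity
  -- `D ^ 2` and `m₂` arise from expanding the square. In states with fewer than `K` messages no
  -- decrease is guaranteed, but the weight is at most `v`, and `2 * D * v` makes up for it.
  refine ⟨D ^ 2 + m₂ + 2 * D * v, fun α hα => ?_⟩
  have hV := hw.weight_nonneg α
  have hg : 0 ≤ 2 * (D - m) * weight w α := mul_nonneg (by linarith) hV
  -- The drift term moves to the right as a truncated subtraction; the last bullet justifies this by
  -- `(weight w α - D) ^ 2 ≥ 0`.
  rw [← ENNReal.ofReal_add (sq_nonneg _) hC,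
    ← ENNReal.le_sub_iff_add_le_right ENNReal.ofReal_ne_top (ENNReal.ofReal_le_ofReal ?_),
    ← ENNReal.ofReal_sub _ hg]
  · refine 𝓜.expect_transition_le ω α _ _ fun T hT => ?_
    have hx := hw.weight_nonneg (𝓜.serve α T)
    have hd := hw.decrease_nonneg (𝓜 := 𝓜) α T
    have hxV := hw.weight_serve_eq (𝓜 := 𝓜) α T
    set x := weight w (𝓜.serve α T) with hxdef
    have hE : expect 𝓜.arrivals (fun a => ENNReal.ofReal
        (weight w (𝓜.serve α T ++ 𝓜.newMessages a) ^ 2)) =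
        ENNReal.ofReal (x ^ 2 + 2 * x * m + m₂) := by
      have : ∀ a, ENNReal.ofReal (weight w (𝓜.serve α T ++ 𝓜.newMessages a) ^ 2) =
          ENNReal.ofReal (x ^ 2) + ENNReal.ofReal (2 * x) * ENNReal.ofReal (𝓜.load w a) +
            ENNReal.ofReal (𝓜.load w a ^ 2) := by
        intro a
        have ha := hw.load_nonneg (𝓜 := 𝓜) a
        rw [IsWeight.weight_serve_append, ← ENNReal.ofReal_mul (by positivity),
          ← ENNReal.ofReal_add (by positivity) (by positivity),
          ← ENNReal.ofReal_add (by positivity) (by positivity)]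
        congr 1
        ring
      simp only [this]
      rw [expect_add, expect_add, expect_const, expect_const_mul, hw.expect_load,
        𝓜.expect_load_sq, ← ENNReal.ofReal_mul (by positivity),
        ← ENNReal.ofReal_add (by positivity) (by positivity),
        ← ENNReal.ofReal_add (by positivity) (by positivity)]
    rw [hE]
    refine ENNReal.ofReal_le_ofReal ?_
    by_cases hK : α.length < K
    · have hVv : weight w α ≤ v := hw.weight_le_of_length_lt hα hK
      have hxle : x ≤ weight w α := by linarith
      have h1 : x ^ 2 ≤ weight w α ^ 2 := by gcongr
      have h2 : x * m ≤ weight w α * m := by gcongr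
      have h3 : D * weight w α ≤ D * v := by gcongr
      nlinarith [sq_nonneg D]
    · have hdD : D ≤ 𝓜.decrease w α T :=
        hD α hα T (by rw [ω.nonIdling α T hT, min_eq_right (not_lt.1 hK)])
      have hxle : x ≤ weight w α - D := by linarith
      have h1 : x ^ 2 ≤ (weight w α - D) ^ 2 := by gcongr
      have h2 : x * m ≤ (weight w α - D) * m := by gcongr
      have h3 : 0 ≤ D * v := mul_nonneg hD0.le hv0
      have h4 : 0 ≤ D * m := mul_nonneg hD0.le hm0
      nlinarith
  · nlinarith [sq_nonneg (weight w α - D), mul_nonneg hm0 hV, mul_nonneg hD0.le hv0]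

/-- If a monotone weight is worked off, in all states with at least `K` messages, at a greater rate
than it arrives, then the chain is positive recurrent and the stationary mean numbers of messages
are finite. -/
theorem posRecurrent_of_weight {K : ℕ} (ω : NonIdlingPolicy L J K) {w : Fin J → ℝ → ℝ}
    (hw : IsWeight w) {c : ℝ} (hc0 : 0 < c) (hc : ∀ j r, 0 < r → c ≤ w j r) {D : ℝ}
    (hD : ∀ α : SysState L J, 𝓜.Admissible α →
      ∀ T : Finset (Fin α.length), T.card = K → D ≤ 𝓜.decrease w α T)
    (hm : 𝓜.meanLoad w < D) {X : Set (SysState L J)} (hXa : ∀ α ∈ X, 𝓜.Admissible α)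
    (hX : IsIrreducibleOn (𝓜.transition ω) X) :
    (∀ α ∈ X, IsPosRecurrentState (𝓜.transition ω) α) ∧
      ∃ π : PMF (SysState L J), IsStationaryOn (𝓜.transition ω) X π ∧
        (∀ π', IsStationaryOn (𝓜.transition ω) X π' → π' = π) ∧
        ∀ l j, ∑' α, π α * (SysState.count α l j : ENNReal) < ⊤ := by
  obtain ⟨C, hdrift⟩ := 𝓜.expect_sq_weight_add_le ω hw hD hm
  set ε := 2 * (D - 𝓜.meanLoad w) with hε
  have hε0 : 0 < ε := by linarith
  have hlen : ∀ α, 𝓜.Admissible α → ε * (α.length * c) ≤ ε * weight w α := fun α hα =>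
    mul_le_mul_of_nonneg_left (IsWeight.length_mul_le_weight hc hα) hε0.le
  obtain ⟨α₀, hα₀⟩ := hX.nonempty
  have hfin : {α | α ∈ X ∧ ENNReal.ofReal (ε * weight w α) ≤ ENNReal.ofReal C + 1}.Finite := by
    refine (𝓜.finite_accessible_length_le ω (hXa α₀ hα₀) ⌊(max C 0 + 1) / (ε * c)⌋₊).subset ?_
    rintro α ⟨hα, hle⟩
    refine ⟨hX.accessible α₀ hα₀ α hα, Nat.le_floor ((le_div_iff₀ (by positivity)).2 ?_)⟩
    have h1 : ENNReal.ofReal C + 1 = ENNReal.ofReal (max C 0 + 1) := by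
      rw [ENNReal.ofReal_add (le_max_right _ _) zero_le_one, ENNReal.ofReal_one, max_comm,
        ENNReal.ofReal_max]
      simp
    rw [h1, ENNReal.ofReal_le_ofReal_iff (by positivity)] at hle
    have := hlen α (hXa α hα)
    linarith
  obtain ⟨hrec, π, hπ, huniq, hmean⟩ := posRecurrent_of_drift hX
    (f := fun α => ENNReal.ofReal (weight w α ^ 2))
    (g := fun α => ENNReal.ofReal (ε * weight w α)) ENNReal.ofReal_ne_top
    (fun _ _ => ENNReal.ofReal_ne_top) (fun α hα => hdrift α (hXa α hα)) hfin
  refine ⟨hrec, π, hπ, huniq, fun l j => ?_⟩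
  have hle : ∀ α, π α * (SysState.count α l j : ENNReal) ≤
      ENNReal.ofReal (1 / (ε * c)) * (π α * ENNReal.ofReal (ε * weight w α)) := by
    intro α
    by_cases hα : α ∈ π.support
    · rw [mul_left_comm]
      gcongr
      rw [← ENNReal.ofReal_mul (by positivity), ← ENNReal.ofReal_natCast]
      refine ENNReal.ofReal_le_ofReal ?_
      have h1 : (SysState.count α l j : ℝ) ≤ α.length := Nat.cast_le.2 List.countP_le_length
      have h2 := hlen α (hXa α (hπ.1 hα))
      rw [one_div, ← div_eq_inv_mul, le_div_iff₀ (by positivity)]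
      nlinarith [mul_pos hε0 hc0]
    · simp [(π.apply_eq_zero_iff α).2 hα]
  refine (ENNReal.tsum_le_tsum hle).trans_lt ?_
  rw [ENNReal.tsum_mul_left]
  exact ENNReal.mul_lt_top ENNReal.ofReal_lt_top hmean.lt_top

theorem scheduleOf_mem_fullSchedules {K : ℕ} {α : SysState L J} {T : Finset (Fin α.length)}
    (hT : T.card = K) : scheduleOf α T ∈ fullSchedules L J K := by
  rw [fullSchedules, Set.mem_ofPred_eq, sum_scheduleOf_eq_card, hT]

theorem scheduleOf_mem_fullSchedulesAt {K : ℕ} {α : SysState L J} {T : Finset (Fin α.length)}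
    (hT : T.card = K) {k : Fin α.length} (hk : k ∈ T) :
    scheduleOf α T ∈ fullSchedulesAt L J K (α.get k).j :=
  ⟨scheduleOf_mem_fullSchedules hT, sum_scheduleOf_pos hk⟩

/-- The number of slots in which a message is served, if it always receives the least quantum. -/
noncomputable def slotWeight (K : ℕ) (j : Fin J) (r : ℝ) : ℝ := ⌈r / 𝓜.φmin K j⌉₊

theorem isWeight_slotWeight {K : ℕ} (hK : 0 < K) : IsWeight (𝓜.slotWeight K) where
  mono j r r' h := Nat.cast_le.2 (Nat.ceil_mono
    (div_le_div_of_nonneg_right h (𝓜.φmin_pos hK j).le))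
  zero j r hr := by
    rw [slotWeight, Nat.ceil_eq_zero.2 (div_nonpos_of_nonpos_of_nonneg hr (𝓜.φmin_pos hK j).le),
      Nat.cast_zero]

theorem one_le_slotWeight {K : ℕ} (hK : 0 < K) (j : Fin J) (r : ℝ) (hr : 0 < r) :
    1 ≤ 𝓜.slotWeight K j r := by
  rw [slotWeight, Nat.one_le_cast, Nat.one_le_ceil_iff]
  exact div_pos hr (𝓜.φmin_pos hK j)

/-- A quantum is at least `φmin`, so it lowers the ceiling by at least one; a departing message had
ceiling at least one. -/
theorem card_le_decrease_slotWeight {K : ℕ} (hK : 0 < K) (α : SysState L J)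
    (hα : 𝓜.Admissible α) (T : Finset (Fin α.length)) (hT : T.card = K) :
    (K : ℝ) ≤ 𝓜.decrease (𝓜.slotWeight K) α T := by
  have hw := 𝓜.isWeight_slotWeight hK
  refine Eq.trans_le (by simp [hT]) (Finset.card_nsmul_le_sum T _ (1 : ℝ) fun k hk => ?_)
  have hφ := 𝓜.φmin_le (scheduleOf_mem_fullSchedulesAt hT hk)
  have hpos := 𝓜.φmin_pos hK (α.get k).j
  have hr := (hα _ (List.get_mem α k)).1
  set q := 𝓜.φ (α.get k).j (scheduleOf α T) with hq
  by_cases hle : (α.get k).residual ≤ q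
  · rw [hw.zero _ _ (sub_nonpos.2 hle), sub_zero]
    exact 𝓜.one_le_slotWeight hK _ _ hr
  · have h1 : 𝓜.slotWeight K (α.get k).j ((α.get k).residual - q) ≤
        𝓜.slotWeight K (α.get k).j ((α.get k).residual - 𝓜.φmin K (α.get k).j) :=
      hw.mono _ (by linarith)
    have h2 : 𝓜.slotWeight K (α.get k).j ((α.get k).residual - 𝓜.φmin K (α.get k).j) + 1 =
        𝓜.slotWeight K (α.get k).j (α.get k).residual := by
      have : 0 ≤ ((α.get k).residual - 𝓜.φmin K (α.get k).j) / 𝓜.φmin K (α.get k).j :=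
        div_nonneg (by linarith) hpos.le
      rw [slotWeight, slotWeight, ← Nat.cast_add_one, ← Nat.ceil_add_one this, sub_div,
        div_self hpos.ne', sub_add_cancel]
    linarith

/-- The residual requirement of a message together with the largest quantum it may receive. -/
noncomputable def quantumWeight (K : ℕ) (j : Fin J) (r : ℝ) : ℝ :=
  if 0 < r then r + 𝓜.φmax K j else 0

theorem isWeight_quantumWeight {K : ℕ} (hK : 0 < K) : IsWeight (𝓜.quantumWeight K) where
  mono j r r' h := by
    have hpos := 𝓜.φmax_pos hK j
    simp only [quantumWeight]
    split_ifs <;> linarith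
  zero j r hr := if_neg (not_lt.2 hr)

/-- A message that stays loses exactly its quantum. One that leaves loses `r + φmax`, which exceeds
the quantum however small `r` was; the summand `φmax` is there for this. -/
theorem φtot_le_decrease_quantumWeight {K : ℕ} (α : SysState L J)
    (hα : 𝓜.Admissible α) (T : Finset (Fin α.length)) (hT : T.card = K) :
    𝓜.φtot K ≤ 𝓜.decrease (𝓜.quantumWeight K) α T := by
  refine (𝓜.φtot_le (scheduleOf_mem_fullSchedules hT)).trans ?_
  rw [← 𝓜.sum_quantum_eq]
  refine Finset.sum_le_sum fun k hk => ?_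
  have hφ := 𝓜.le_φmax (scheduleOf_mem_fullSchedulesAt hT hk)
  have hr := (hα _ (List.get_mem α k)).1
  simp only [Finset.mem_univ, if_true, quantumWeight, hr]
  split_ifs <;> linarith

/-! ### Instability -/

variable {𝓜} in
/-- From a state with sufficiently many messages, states of arbitrarily large weight are
accessible if the arrivals of a slot may exceed the weight that can be worked off in a slot. -/
theorem exists_accessible_weight_ge {K : ℕ} (ω : NonIdlingPolicy L J K) {w : Fin J → ℝ → ℝ}
    (hw : IsWeight w) {D : ℝ} (hD : ∀ α : SysState L J, 𝓜.Admissible α →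
      ∀ T : Finset (Fin α.length), T.card = K → 𝓜.decrease w α T ≤ D)
    {a : Schedule L J} (ha : a ∈ 𝓜.arrivals.support) (N : ℕ) {α : SysState L J}
    (hα : 𝓜.Admissible α) (hN : N * K ≤ α.length) :
    ∃ β, Accessible (𝓜.transition ω) α β ∧ weight w α + N * (𝓜.load w a - D) ≤ weight w β := by
  induction N generalizing α with
  | zero => exact ⟨α, Relation.ReflTransGen.refl, by simp⟩
  | succ N ih =>
    obtain ⟨T, hT⟩ := (ω.select α).support_nonempty
    have hK : K ≤ α.length := (Nat.le_mul_of_pos_left K N.succ_pos).trans hN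
    have hcard : T.card = K := by rw [ω.nonIdling α T hT, min_eq_right hK]
    have hlen := 𝓜.length_le_length_serve hα T
    -- At most `K` messages leave in the slot, so enough remain for full service in the other `N`
    -- slots.
    obtain ⟨β, hβ, hle⟩ := ih (hα.serve_append T a) (by
      rw [List.length_append]
      rw [add_mul] at hN
      omega)
    refine ⟨β, hβ.head ((𝓜.mem_support_transition).2 ⟨T, hT, a, ha, rfl⟩), le_trans ?_ hle⟩
    rw [IsWeight.weight_serve_append, hw.weight_serve_eq]
    have := hD α hα T hcard
    push_cast
    linarith

theorem exists_mem_support_load_gt {w : Fin J → ℝ → ℝ} (hw : IsWeight w) {D : ℝ} (hD0 : 0 ≤ D)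
    (hm : D < 𝓜.meanLoad w) : ∃ a ∈ 𝓜.arrivals.support, D < 𝓜.load w a := by
  by_contra! hne
  have h := expect_mono (p := 𝓜.arrivals) (f := fun a => ENNReal.ofReal (𝓜.load w a))
    (g := fun _ => ENNReal.ofReal D) fun a ha => ENNReal.ofReal_le_ofReal (hne a ha)
  rw [hw.expect_load, expect_const, ENNReal.ofReal_le_ofReal_iff hD0] at h
  exact absurd hm (not_lt.2 h)

/-- The product of `1 + z + z²/2`, a lower bound for `exp z`, and `1 - z + z²/2` is `1 + z⁴/4 ≥ 1`.
-/
theorem exp_neg_add_le {z : ℝ} (hz : 0 ≤ z) : Real.exp (-z) + z ≤ 1 + z ^ 2 / 2 := by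
  have h1 := Real.quadratic_le_exp_of_nonneg hz
  have h2 : Real.exp (-z) ≤ 1 - z + z ^ 2 / 2 := by
    rw [Real.exp_neg, inv_le_comm₀ (Real.exp_pos z) (by nlinarith [sq_nonneg (z - 1)])]
    refine le_trans ?_ h1
    rw [inv_le_iff_one_le_mul₀ (by nlinarith [sq_nonneg (z - 1)])]
    nlinarith [sq_nonneg (z ^ 2)]
  linarith

/-- If the mean load exceeds `D`, then the load has a small negative exponential moment at most that
of `D`. -/
theorem exists_expect_exp_load_le {w : Fin J → ℝ → ℝ} (hw : IsWeight w) {D : ℝ}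
    (hm : D < 𝓜.meanLoad w) : ∃ θ : ℝ, 0 < θ ∧
      expect 𝓜.arrivals (fun a => ENNReal.ofReal (Real.exp (-(θ * 𝓜.load w a)))) ≤
        ENNReal.ofReal (Real.exp (-(θ * D))) := by
  set m := 𝓜.meanLoad w with hmdef
  set m₂ := 𝓜.secondMomentLoad w with hm₂def
  have hm0 : 0 ≤ m := hw.meanLoad_nonneg
  have hm₂0 : 0 ≤ m₂ := 𝓜.secondMomentLoad_nonneg w
  -- This choice gives `1 - θm + θ²m₂/2 ≤ 1 - θD ≤ exp (-θD)`; the added one keeps the denominator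
  -- positive.
  set θ := (m - D) / (m₂ + 1) with hθ
  have hθ0 : 0 < θ := div_pos (sub_pos.2 hm) (by linarith)
  have hθm : θ * (m₂ + 1) = m - D := div_mul_cancel₀ _ (by linarith)
  refine ⟨θ, hθ0, ?_⟩
  have h1 : expect 𝓜.arrivals (fun a => ENNReal.ofReal (Real.exp (-(θ * 𝓜.load w a)))) +
      ENNReal.ofReal (θ * m) ≤ ENNReal.ofReal (1 + θ ^ 2 / 2 * m₂) := by
    have h2 : expect 𝓜.arrivals (fun a => ENNReal.ofReal (Real.exp (-(θ * 𝓜.load w a))) +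
        ENNReal.ofReal θ * ENNReal.ofReal (𝓜.load w a)) ≤ expect 𝓜.arrivals (fun a => 1 +
        ENNReal.ofReal (θ ^ 2 / 2) * ENNReal.ofReal (𝓜.load w a ^ 2)) := by
      refine expect_mono fun a _ => ?_
      have ha := hw.load_nonneg (𝓜 := 𝓜) a
      rw [← ENNReal.ofReal_mul hθ0.le, ← ENNReal.ofReal_mul (by positivity),
        ← ENNReal.ofReal_add (Real.exp_pos _).le (by positivity), ← ENNReal.ofReal_one,
        ← ENNReal.ofReal_add zero_le_one (by positivity)]
      refine ENNReal.ofReal_le_ofReal ((exp_neg_add_le (by positivity)).trans_eq ?_)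
      ring
    rw [expect_add, expect_add, expect_const_mul, expect_const_mul, expect_const, hw.expect_load,
      𝓜.expect_load_sq, ← ENNReal.ofReal_mul hθ0.le, ← ENNReal.ofReal_mul (by positivity),
      ← ENNReal.ofReal_one, ← ENNReal.ofReal_add zero_le_one (by positivity)] at h2
    exact h2
  refine (ENNReal.le_sub_of_add_le_right ENNReal.ofReal_ne_top h1).trans ?_
  rw [← ENNReal.ofReal_sub _ (by positivity)]
  refine ENNReal.ofReal_le_ofReal (le_trans ?_ (Real.add_one_le_exp _))
  nlinarith [mul_nonneg (sq_nonneg θ) hm₂0]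

/-- If a monotone weight is worked off, in all states with at least `K` messages, at a smaller rate
than it arrives, then the states from which infinitely many states are accessible are transient. -/
theorem isTransientState_of_weight {K : ℕ} (ω : NonIdlingPolicy L J K) {w : Fin J → ℝ → ℝ}
    (hw : IsWeight w) {D : ℝ} (hD0 : 0 ≤ D) (hD : ∀ α : SysState L J, 𝓜.Admissible α →
      ∀ T : Finset (Fin α.length), T.card = K → 𝓜.decrease w α T ≤ D)
    (hm : D < 𝓜.meanLoad w) {α : SysState L J} (hα : 𝓜.Admissible α)
    (hinf : {β | Accessible (𝓜.transition ω) α β}.Infinite) :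
    IsTransientState (𝓜.transition ω) α := by
  obtain ⟨θ, hθ, hexp⟩ := 𝓜.exists_expect_exp_load_le hw hm
  -- The level `v` dominates the weight of `α` and of every admissible state with fewer than `K`
  -- messages, so the truncated exponential below equals one at all of them.
  set v := max (K * ∑ l, ∑ j, w j (𝓜.S l)) (weight w α) with hv
  obtain ⟨β, hβ, hβv⟩ : ∃ β, Accessible (𝓜.transition ω) α β ∧ v < weight w β := by
    obtain ⟨a, ha, haD⟩ := 𝓜.exists_mem_support_load_gt hw hD0 hm
    obtain ⟨N, hN⟩ := exists_nat_gt (v / (𝓜.load w a - D))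
    rw [div_lt_iff₀ (sub_pos.2 haD)] at hN
    obtain ⟨γ, hγ, hlen⟩ : ∃ γ, Accessible (𝓜.transition ω) α γ ∧ N * K ≤ γ.length := by
      by_contra! hne
      exact hinf ((𝓜.finite_accessible_length_le ω hα (N * K)).subset
        fun γ hγ => ⟨hγ, (hne γ hγ).le⟩)
    obtain ⟨β, hβ, hle⟩ :=
      exists_accessible_weight_ge ω hw hD ha N (hα.of_accessible hγ) hlen
    have := hw.weight_nonneg γ
    exact ⟨β, hγ.trans hβ, by linarith⟩
  refine isTransientState_of_superharmonic
    (fun γ => min 1 (ENNReal.ofReal (Real.exp (-(θ * (weight w γ - v)))))) ?_ ?_ hβ ?_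
  · intro γ hγ
    have hγa := hα.of_accessible hγ
    refine le_min ((expect_mono fun _ _ => min_le_left _ _).trans_eq (expect_const _ _)) ?_
    -- With fewer than `K` messages the function already has its maximal value one. Otherwise
    -- service raises the exponential by at most `exp (θD)`, which the mean over arrivals cancels.
    by_cases hK : γ.length < K
    · have hle : weight w γ ≤ v :=
        (hw.weight_le_of_length_lt hγa hK).trans (le_max_left _ _)
      refine ((expect_mono fun _ _ => min_le_left _ _).trans_eq (expect_const _ _)).trans ?_
      rw [ENNReal.one_le_ofReal, Real.one_le_exp_iff]
      nlinarith
    · refine (expect_mono fun _ _ => min_le_right _ _).trans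
        (𝓜.expect_transition_le ω γ _ _ fun T hT => ?_)
      have hd := hD γ hγa T (by rw [ω.nonIdling γ T hT, min_eq_right (not_lt.1 hK)])
      have hx := hw.weight_serve_eq (𝓜 := 𝓜) γ T
      have hfac : ∀ a, ENNReal.ofReal (Real.exp
          (-(θ * (weight w (𝓜.serve γ T ++ 𝓜.newMessages a) - v)))) =
          ENNReal.ofReal (Real.exp (-(θ * (weight w (𝓜.serve γ T) - v)))) *
            ENNReal.ofReal (Real.exp (-(θ * 𝓜.load w a))) := by
        intro a
        rw [← ENNReal.ofReal_mul (Real.exp_pos _).le, ← Real.exp_add,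
          IsWeight.weight_serve_append]
        congr 2
        ring
      simp only [hfac]
      rw [expect_const_mul]
      refine (mul_le_mul_right hexp _).trans ?_
      rw [← ENNReal.ofReal_mul (Real.exp_pos _).le, ← Real.exp_add]
      refine ENNReal.ofReal_le_ofReal (Real.exp_le_exp.2 ?_)
      nlinarith
  · refine le_min le_rfl ?_
    rw [ENNReal.one_le_ofReal, Real.one_le_exp_iff]
    have : weight w α ≤ v := le_max_right _ _
    nlinarith
  · refine (min_le_right _ _).trans_lt ?_
    rw [ENNReal.ofReal_lt_one, Real.exp_lt_one_iff]
    nlinarith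

/-! ### The weight for instability -/

/-- The least total of quanta of full schedules that exhausts the residual requirement `r` of a
message of power class `j`, if `j` is in `B`. -/
noncomputable def exhaustingWeight (K : ℕ) (B : Finset (Fin J)) (j : Fin J) (r : ℝ) : ℝ :=
  if j ∈ B then sInf {t | t ∈ AddSubmonoid.closure (𝓜.φ j '' fullSchedulesAt L J K j) ∧ r ≤ t}
  else 0

section ExhaustingWeight

variable {K : ℕ} {j : Fin J}

theorem quantum_pos {g : ℝ} (hg : g ∈ 𝓜.φ j '' fullSchedulesAt L J K j) : 0 < g := by
  obtain ⟨s, hs, rfl⟩ := hg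
  exact 𝓜.φ_pos hs.2

theorem exists_closure_ge (hK : 0 < K) (j : Fin J) (r : ℝ) :
    {t | t ∈ AddSubmonoid.closure (𝓜.φ j '' fullSchedulesAt L J K j) ∧ r ≤ t}.Nonempty := by
  obtain ⟨s, hs⟩ := fullSchedulesAt_nonempty (J := J) 𝓜.L_pos hK j
  obtain ⟨n, hn⟩ := Archimedean.arch r (𝓜.φ_pos hs.2)
  exact ⟨_, nsmul_mem (AddSubmonoid.subset_closure (Set.mem_image_of_mem _ hs)) n, hn⟩

theorem bddBelow_closure_ge (K : ℕ) (j : Fin J) (r : ℝ) :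
    BddBelow {t | t ∈ AddSubmonoid.closure (𝓜.φ j '' fullSchedulesAt L J K j) ∧ r ≤ t} :=
  ⟨r, fun _ ht => ht.2⟩

theorem le_exhaustingWeight (hK : 0 < K) {B : Finset (Fin J)} (hj : j ∈ B) (r : ℝ) :
    r ≤ 𝓜.exhaustingWeight K B j r := by
  rw [exhaustingWeight, if_pos hj]
  exact le_csInf (𝓜.exists_closure_ge hK j r) fun t ht => ht.2

/-- The monoid has finite initial segments, so the infimum is attained at one of its elements;
equality with `r` would put `r` in the monoid. -/
theorem lt_exhaustingWeight (hK : 0 < K) {B : Finset (Fin J)} (hj : j ∈ B) {r : ℝ}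
    (hr : r ∉ AddSubmonoid.closure (𝓜.φ j '' fullSchedulesAt L J K j)) :
    r < 𝓜.exhaustingWeight K B j r := by
  rw [exhaustingWeight, if_pos hj]
  obtain ⟨t₀, ht₀, hrt₀⟩ := 𝓜.exists_closure_ge hK j r
  have hfin : {t | (t ∈ AddSubmonoid.closure (𝓜.φ j '' fullSchedulesAt L J K j) ∧ t ≤ t₀) ∧
      r ≤ t}.Finite :=
    (AddSubmonoid.finite_closure_le ((finite_fullSchedulesAt L J K j).image _)
      (fun _ => 𝓜.quantum_pos) t₀).subset fun _ ht => ht.1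
  obtain ⟨t₁, ⟨⟨ht₁, ht₁₀⟩, hrt₁⟩, hmin⟩ :=
    Set.exists_min_image _ id hfin ⟨t₀, ⟨ht₀, le_rfl⟩, hrt₀⟩
  have hleast : IsLeast {t | t ∈ AddSubmonoid.closure (𝓜.φ j '' fullSchedulesAt L J K j) ∧
      r ≤ t} t₁ := by
    refine ⟨⟨ht₁, hrt₁⟩, fun t ht => ?_⟩
    rcases le_total t t₀ with h | h
    · exact hmin t ⟨⟨ht.1, h⟩, ht.2⟩
    · exact ht₁₀.trans h
  rw [hleast.csInf_eq]
  exact lt_of_le_of_ne hrt₁ fun h => hr (h ▸ ht₁)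

theorem isWeight_exhaustingWeight (hK : 0 < K) (B : Finset (Fin J)) :
    IsWeight (𝓜.exhaustingWeight K B) where
  mono j r r' h := by
    simp only [exhaustingWeight]
    split_ifs
    · exact csInf_le_csInf (𝓜.bddBelow_closure_ge K j r) (𝓜.exists_closure_ge hK j r')
        fun t ht => ⟨ht.1, h.trans ht.2⟩
    · exact le_rfl
  zero j r hr := by
    rw [exhaustingWeight]
    split_ifs
    · exact IsLeast.csInf_eq ⟨⟨zero_mem _, hr⟩, fun t ht =>
        AddSubmonoid.nonneg_of_mem_closure (fun _ => 𝓜.quantum_pos) ht.1⟩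
    · rfl

/-- If `t` covers `r - φ`, then `t + φ` covers `r` and is again a sum of full-schedule quanta. -/
theorem exhaustingWeight_le_add (hK : 0 < K) {B : Finset (Fin J)} (hj : j ∈ B)
    {s : Schedule L J} (hs : s ∈ fullSchedulesAt L J K j) (r : ℝ) :
    𝓜.exhaustingWeight K B j r ≤ 𝓜.exhaustingWeight K B j (r - 𝓜.φ j s) + 𝓜.φ j s := by
  simp only [exhaustingWeight, if_pos hj]
  rw [← sub_le_iff_le_add]
  refine le_csInf (𝓜.exists_closure_ge hK j _) fun t ht => ?_
  rw [sub_le_iff_le_add]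
  exact csInf_le (𝓜.bddBelow_closure_ge K j r) ⟨add_mem ht.1
    (AddSubmonoid.subset_closure (Set.mem_image_of_mem _ hs)), sub_le_iff_le_add.1 ht.2⟩

end ExhaustingWeight

theorem decrease_exhaustingWeight_le {K : ℕ} (hK : 0 < K) (B : Finset (Fin J))
    (α : SysState L J) (T : Finset (Fin α.length)) (hT : T.card = K) :
    𝓜.decrease (𝓜.exhaustingWeight K B) α T ≤ 𝓜.maxQuantum K B := by
  refine le_trans ?_ (𝓜.le_maxQuantum B (scheduleOf_mem_fullSchedules hT))
  rw [← 𝓜.sum_quantum_eq]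
  refine Finset.sum_le_sum fun k hk => ?_
  by_cases hj : (α.get k).j ∈ B
  · rw [if_pos hj, sub_le_iff_le_add']
    exact 𝓜.exhaustingWeight_le_add hK hj (scheduleOf_mem_fullSchedulesAt hT hk) _
  · rw [if_neg hj, exhaustingWeight, exhaustingWeight, if_neg hj, if_neg hj, sub_zero]

theorem maxQuantum_nonneg (K : ℕ) (B : Finset (Fin J)) : 0 ≤ 𝓜.maxQuantum K B :=
  Real.sSup_nonneg fun x hx => by
    obtain ⟨s, -, rfl⟩ := hx
    exact Finset.sum_nonneg fun _ _ => Finset.sum_nonneg fun _ _ =>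
      mul_nonneg (Nat.cast_nonneg _) (𝓜.φ_nonneg _ _)

theorem meanLoad_exhaustingWeight (K : ℕ) (B : Finset (Fin J)) :
    𝓜.meanLoad (𝓜.exhaustingWeight K B) =
      ∑ l, ∑ j ∈ B, 𝓜.exhaustingWeight K B j (𝓜.S l) * 𝓜.meanA l j := by
  refine Finset.sum_congr rfl fun l _ => ?_
  simp only [mul_comm (𝓜.meanA l _)]
  refine (Finset.sum_subset (Finset.subset_univ B) fun j _ hj => ?_).symm
  rw [exhaustingWeight, if_neg hj, zero_mul]

theorem maxQuantum_lt_meanLoad {K : ℕ} (hK : 0 < K) {B : Finset (Fin J)}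
    (h : 𝓜.maxQuantum K B < ∑ l, ∑ j ∈ B, 𝓜.S l * 𝓜.meanA l j ∨
      (𝓜.maxQuantum K B = ∑ l, ∑ j ∈ B, 𝓜.S l * 𝓜.meanA l j ∧
        ∃ l, ∃ j ∈ B, 0 < 𝓜.meanA l j ∧
          𝓜.S l ∉ AddSubmonoid.closure (𝓜.φ j '' fullSchedulesAt L J K j))) :
    𝓜.maxQuantum K B < 𝓜.meanLoad (𝓜.exhaustingWeight K B) := by
  rw [meanLoad_exhaustingWeight]
  have hterm : ∀ l, ∀ j ∈ B,
      𝓜.S l * 𝓜.meanA l j ≤ 𝓜.exhaustingWeight K B j (𝓜.S l) * 𝓜.meanA l j := fun l j hj =>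
    mul_le_mul_of_nonneg_right (𝓜.le_exhaustingWeight hK hj _) (𝓜.meanA_nonneg l j)
  rcases h with h | ⟨h, l, j, hj, hA, hS⟩
  · exact h.trans_le (Finset.sum_le_sum fun l _ => Finset.sum_le_sum (hterm l))
  · rw [h]
    exact Finset.sum_lt_sum (fun l _ => Finset.sum_le_sum (hterm l)) ⟨l, Finset.mem_univ l,
      Finset.sum_lt_sum (hterm l) ⟨j, hj,
        mul_lt_mul_of_pos_right (𝓜.lt_exhaustingWeight hK hj hS) hA⟩⟩

end MessageSystem

/-! ### The theorem -/

open MarkovChain in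
theorem mainTheorem1 {L J K : ℕ} (hK : 2 ≤ K) (𝓜 : MessageSystem L J)
    (ω : NonIdlingPolicy L J K) :
    ((∑ l, ∑ j, 𝓜.meanA l j * (⌈𝓜.S l / 𝓜.φmin K j⌉₊ : ℝ) < K ∨
        ∑ l, ∑ j, 𝓜.meanA l j * (𝓜.S l + 𝓜.φmax K j) < 𝓜.φtot K) →
      ∀ X : Set (SysState L J), (∀ α ∈ X, 𝓜.Admissible α) →
        IsIrreducibleOn (𝓜.transition ω) X →
        (∀ α ∈ X, IsPosRecurrentState (𝓜.transition ω) α) ∧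
        ∃ π : PMF (SysState L J), IsStationaryOn (𝓜.transition ω) X π ∧
          (∀ π', IsStationaryOn (𝓜.transition ω) X π' → π' = π) ∧
          ∀ l j, ∑' α, π α * (SysState.count α l j : ENNReal) < ⊤) ∧
    (∀ B : Finset (Fin J), B.Nonempty →
      (𝓜.maxQuantum K B < ∑ l, ∑ j ∈ B, 𝓜.S l * 𝓜.meanA l j ∨
        (𝓜.maxQuantum K B = ∑ l, ∑ j ∈ B, 𝓜.S l * 𝓜.meanA l j ∧
          ∃ l, ∃ j ∈ B, 0 < 𝓜.meanA l j ∧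
            𝓜.S l ∉ AddSubmonoid.closure (𝓜.φ j '' MessageSystem.fullSchedulesAt L J K j))) →
      ∀ α, 𝓜.Admissible α → {β | Accessible (𝓜.transition ω) α β}.Infinite →
        IsTransientState (𝓜.transition ω) α) := by
  have hK0 : 0 < K := by omega
  refine ⟨fun h X hXa hX => ?_, fun B _ h α hα hinf => ?_⟩
  · rcases h with h | h
    · exact 𝓜.posRecurrent_of_weight ω (𝓜.isWeight_slotWeight hK0) one_pos
        (𝓜.one_le_slotWeight hK0) (𝓜.card_le_decrease_slotWeight hK0) h hXa hX
    · have : Nonempty (Fin J) := ⟨⟨0, 𝓜.J_pos⟩⟩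
      -- The smallest `φmax` is a positive lower bound for the weight of any message present.
      obtain ⟨j₀, hj₀⟩ := Finite.exists_min (𝓜.φmax K)
      refine 𝓜.posRecurrent_of_weight ω (𝓜.isWeight_quantumWeight hK0) (𝓜.φmax_pos hK0 j₀)
        (fun j r hr => ?_) 𝓜.φtot_le_decrease_quantumWeight ?_ hXa hX
      · rw [MessageSystem.quantumWeight, if_pos hr]
        linarith [hj₀ j]
      · simpa only [MessageSystem.meanLoad, MessageSystem.quantumWeight, if_pos (𝓜.S_pos _)]
          using h
  · exact 𝓜.isTransientState_of_weight ω (𝓜.isWeight_exhaustingWeight hK0 B)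
      (𝓜.maxQuantum_nonneg K B)
      (fun α _ T hT => 𝓜.decrease_exhaustingWeight_le hK0 B α T hT)
      (𝓜.maxQuantum_lt_meanLoad hK0 h) hα hinf
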